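/- Let $(M,g)$ be a smooth finite-dimensional Riemannian manifold (Hausdorff, second countable, without boundary), $W\in C^\infty(M)$, let $f_1,\dots,f_m$ be smooth vector fields on $M$, let $\Omega\subset\mathbb{R}^m$ be nonempty, convex and compact, let $K\subset TM$ be compact, and let $(q_0,v_0)\in TM$. For $u\in L^2([0,t],\Omega)$ consider the controlled dynamics $$q'=v,\qquad \frac{Dv}{Dt}=-\operatorname{grad}_g W(q)+\sum_{j=1}^m u_j\,f_j(q)\quad\text{a.e. on }[0,t],\qquad (q,v)(0)=(q_0,v_0),$$ where $D/Dt$ is the covariant derivative of the Levi-Civita connection along $q$, and a trajectory $(q,v):[0,t]\to TM$ is a continuous curve that is absolutely continuous in charts. For $t\ge 0$ let the accessible set $Acc_t(q_0,v_0)\subset TM$ be the set of end points $(q(t),v(t))$ of those trajectories with a control $u\in L^2([0,t],\Omega)$ that are defined on $[0,t]$ and lie in $K$. (1) For every $t\ge 0$ the set $Acc_t(q_0,v_0)$ is compact. (2) Let $T\ge 0$ and suppose that trajectories stay in $K$: for every $r\in[0,T]$, every trajectory on $[0,r]$ that starts at $(q_0,v_0)$ and is driven by a control in $L^2([0,r],\Omega)$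 lies in $K$. Then $t\mapsto Acc_t(q_0,v_0)$ is continuous on $[0,T]$ for the Hausdorff distance associated with any (possibly infinite-valued) distance on $TM$ that induces its topology. -/

import Mathlib

open Set Filter Topology MeasureTheory
open scoped Manifold ContDiff ENNReal

noncomputable section

namespace RobotControl

variable {E : Type*} [NormedAddCommGroup E] [NormedSpace ℝ E]
  {M : Type*} [TopologicalSpace M] [ChartedSpace E M] [IsManifold 𝓘(ℝ, E) ∞ M]

/-- A smooth Riemannian metric on the manifold `M` (modelled on `E`). -/
abbrev RiemMetric (E : Type*) [NormedAddCommGroup E] [NormedSpace ℝ E]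
    (M : Type*) [TopologicalSpace M] [ChartedSpace E M] [IsManifold 𝓘(ℝ, E) ∞ M] :=
  Bundle.ContMDiffRiemannianMetric 𝓘(ℝ, E) ∞ E (fun q : M => TangentSpace 𝓘(ℝ, E) q)

/-- A vector field on `M` is smooth: it is smooth as a map `M → TM`. -/
def SmoothVectorField (X : ∀ q : M, TangentSpace 𝓘(ℝ, E) q) : Prop :=
  ContMDiff 𝓘(ℝ, E) 𝓘(ℝ, E).tangent ∞ (fun q => (⟨q, X q⟩ : TangentBundle 𝓘(ℝ, E) M))

/-- The gradient `grad_g W`: the image of `dW` under the isomorphism `T*M → TM` inverse to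
`v ↦ g(v, ·)`. -/
def grad (g : RiemMetric E M) (W : M → ℝ) (q : M) : TangentSpace 𝓘(ℝ, E) q :=
  (g.inner q).inverse (mfderiv 𝓘(ℝ, E) 𝓘(ℝ, ℝ) W q)

/-- The components in `E`, in the chart of the atlas attached to `p`, of a tangent vector `v` at a
point `q` of that chart (the image of `v` under the differential of the chart). -/
def tangentCoord (p q : M) (v : TangentSpace 𝓘(ℝ, E) q) : E :=
  (trivializationAt E (fun q : M => TangentSpace 𝓘(ℝ, E) q) p).continuousLinearMapAt ℝ q v

/-- The components `g_{ij}(x)` of the metric in the chart attached to `p`, at the point of `M` with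
coordinates `x`, as a bilinear form on `E`. -/
def metricInChart (g : RiemMetric E M) (p : M) (x : E) : E →L[ℝ] E →L[ℝ] ℝ :=
  let q : M := (chartAt E p).symm x
  let B : E →L[ℝ] E →L[ℝ] ℝ := g.inner q
  let S : E →L[ℝ] E := (trivializationAt E (fun q : M => TangentSpace 𝓘(ℝ, E) q) p).symmL ℝ q
  B.bilinearComp S S

/-- The Christoffel symbols of the first kind in the chart attached to `p`: the linear form
`c ↦ ½ (∂_a g(b, c) + ∂_b g(a, c) - ∂_c g(a, b))`. -/
def christoffelFirst (g : RiemMetric E M) (p : M) (x a b : E) : E →L[ℝ] ℝ :=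
  let D : E →L[ℝ] E →L[ℝ] E →L[ℝ] ℝ := fderiv ℝ (metricInChart g p) x
  (1 / 2 : ℝ) • (D a b + D b a - (D.flip a).flip b)

/-- The Christoffel symbols `Γ(x)(a, b) = Γ^k_{ij}(x) a^i b^j` of the Levi-Civita connection in the
chart attached to `p`. -/
def christoffel (g : RiemMetric E M) (p : M) (x a b : E) : E :=
  (metricInChart g p x).inverse (christoffelFirst g p x a b)

/-- On `[a, b]` the function `f` is absolutely continuous with derivative `F` almost everywhere:
`F` is integrable and `f t = f a + ∫ s in a..t, F s`. -/
def HasACDeriv (f F : ℝ → E) (a b : ℝ) : Prop :=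
  IntervalIntegrable F volume a b ∧ ∀ t ∈ Icc a b, f t = f a + ∫ s in a..t, F s

/-- `[a, b]` is a subinterval of `[0, T]` that `q` maps into the chart attached to `p`. -/
def InChart (E : Type*) [NormedAddCommGroup E] {M : Type*} [TopologicalSpace M] [ChartedSpace E M]
    (T : ℝ) (q : ℝ → M) (p : M) (a b : ℝ) : Prop :=
  0 ≤ a ∧ a ≤ b ∧ b ≤ T ∧ ∀ t ∈ Icc a b, q t ∈ (chartAt E p).source

/-- The curve `q` is absolutely continuous on `[0, T]`, with velocity `v`. -/
def HasVelocity (T : ℝ) (q : ℝ → M) (v : ∀ t, TangentSpace 𝓘(ℝ, E) (q t)) : Prop :=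
  ContinuousOn q (Icc 0 T) ∧
  ∀ p a b, InChart E T q p a b →
    HasACDeriv (fun t => chartAt E p (q t)) (fun t => tangentCoord p (q t) (v t)) a b

/-- Along the curve `q` with velocity `v`, the vector field `V` is absolutely continuous on `[0, T]`
and its covariant derivative `DV/Dt` (for the Levi-Civita connection of `g`) is `A` almost
everywhere: in every chart `dV/dt + Γ(q)(v, V) = A`. -/
def HasCovariantDeriv (g : RiemMetric E M) (T : ℝ) (q : ℝ → M)
    (v V A : ∀ t, TangentSpace 𝓘(ℝ, E) (q t)) : Prop :=
  ContinuousOn (fun t => (⟨q t, V t⟩ : TangentBundle 𝓘(ℝ, E) M)) (Icc 0 T) ∧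
  ∀ p a b, InChart E T q p a b →
    HasACDeriv (fun t => tangentCoord p (q t) (V t))
      (fun t => tangentCoord p (q t) (A t) -
        christoffel g p (chartAt E p (q t))
          (tangentCoord p (q t) (v t)) (tangentCoord p (q t) (V t))) a b

/-- The controls: elements of `L²([0, T], Ω)`. -/
def IsControl {m : ℕ} (Ω : Set (EuclideanSpace ℝ (Fin m))) (T : ℝ)
    (u : ℝ → EuclideanSpace ℝ (Fin m)) : Prop :=
  MemLp u 2 (volume.restrict (Icc 0 T)) ∧ ∀ᵐ t ∂(volume.restrict (Icc 0 T)), u t ∈ Ω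

/-- The right-hand side `-grad W (q) + ∑ j, u_j f_j(q)` of the controlled dynamics. -/
def force {m : ℕ} (g : RiemMetric E M) (W : M → ℝ)
    (f : Fin m → ∀ q : M, TangentSpace 𝓘(ℝ, E) q) (u : EuclideanSpace ℝ (Fin m)) (q : M) :
    TangentSpace 𝓘(ℝ, E) q :=
  -grad g W q + ∑ j, u j • f j q

/-- The curve `γ = (q, v)` in `TM` solves `q' = v`, `Dv/Dt = -grad W (q) + ∑ j, u_j f_j(q)`
on `[0, T]`. -/
def IsTrajectory {m : ℕ} (g : RiemMetric E M) (W : M → ℝ)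
    (f : Fin m → ∀ q : M, TangentSpace 𝓘(ℝ, E) q) (T : ℝ)
    (u : ℝ → EuclideanSpace ℝ (Fin m)) (γ : ℝ → TangentBundle 𝓘(ℝ, E) M) : Prop :=
  HasVelocity T (fun t => (γ t).proj) (fun t => (γ t).snd) ∧
  HasCovariantDeriv g T (fun t => (γ t).proj) (fun t => (γ t).snd) (fun t => (γ t).snd)
    (fun t => force g W f (u t) (γ t).proj)

/-- `Acc_T(x₀)`: the end points at time `T` of the trajectories that start at `x₀ = (q₀, v₀)`, are
driven by a control in `L²([0, T], Ω)`, are defined on `[0, T]` and lie in `K`. -/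
def accessibleSet {m : ℕ} (g : RiemMetric E M) (W : M → ℝ)
    (f : Fin m → ∀ q : M, TangentSpace 𝓘(ℝ, E) q) (Ω : Set (EuclideanSpace ℝ (Fin m)))
    (K : Set (TangentBundle 𝓘(ℝ, E) M)) (x₀ : TangentBundle 𝓘(ℝ, E) M) (T : ℝ) :
    Set (TangentBundle 𝓘(ℝ, E) M) :=
  {x | ∃ u γ, IsControl Ω T u ∧ IsTrajectory g W f T u γ ∧ γ 0 = x₀ ∧
    (∀ t ∈ Icc 0 T, γ t ∈ K) ∧ γ T = x}

/-- Every trajectory that starts at `x₀` and is driven by a control with values in `Ω` stays in `K`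
for as long as it is defined, up to time `T`. -/
def TrajectoriesStayIn {m : ℕ} (g : RiemMetric E M) (W : M → ℝ)
    (f : Fin m → ∀ q : M, TangentSpace 𝓘(ℝ, E) q) (Ω : Set (EuclideanSpace ℝ (Fin m)))
    (K : Set (TangentBundle 𝓘(ℝ, E) M)) (x₀ : TangentBundle 𝓘(ℝ, E) M) (T : ℝ) : Prop :=
  ∀ r ∈ Icc 0 T, ∀ u γ, IsControl Ω r u → IsTrajectory g W f r u γ → γ 0 = x₀ →
    ∀ t ∈ Icc 0 r, γ t ∈ K

/-- The set-valued map `A` is continuous on `S` for the Hausdorff distance, whatever (possibly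
infinite-valued) distance inducing the topology of `X` is used. -/
def HausdorffContinuousOn {X : Type*} [τ : TopologicalSpace X] (A : ℝ → Set X) (S : Set ℝ) : Prop :=
  ∀ d : EMetricSpace X, d.toUniformSpace.toTopologicalSpace = τ →
    ∀ t ∈ S, Tendsto (fun s => @Metric.hausdorffEDist X d.toPseudoEMetricSpace (A s) (A t))
      (𝓝[S] t) (𝓝 0)

/-! The inverses used in `grad` and `christoffel` are genuine inverses. -/

theorem apply_inverse_of_pos [FiniteDimensional ℝ E] (B : E →L[ℝ] E →L[ℝ] ℝ)
    (hB : ∀ v, v ≠ 0 → 0 < B v v) (ℓ : E →L[ℝ] ℝ) : B (B.inverse ℓ) = ℓ := by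
  have hinj : Function.Injective (B : E →ₗ[ℝ] E →L[ℝ] ℝ) := by
    rw [injective_iff_map_eq_zero]
    intro v hv
    by_contra hne
    have h := hB v hne
    have h0 : B v = 0 := hv
    simp [h0] at h
  have hdim : Module.finrank ℝ E = Module.finrank ℝ (E →L[ℝ] ℝ) := by
    rw [← (LinearMap.toContinuousLinearMap (𝕜 := ℝ) (E := E) (F' := ℝ)).finrank_eq]
    exact (Subspace.dual_finrank_eq (K := ℝ) (V := E)).symm
  let e : E ≃L[ℝ] (E →L[ℝ] ℝ) :=
    (LinearEquiv.ofInjectiveOfFinrankEq (B : E →ₗ[ℝ] E →L[ℝ] ℝ) hinj hdim).toContinuousLinearEquiv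
  have he : (e : E →L[ℝ] E →L[ℝ] ℝ) = B := by
    ext v w
    rfl
  have hI : B.IsInvertible := ⟨e, he⟩
  exact ((hI.inverse_apply_eq (y := ℓ)).1 rfl).symm

theorem inner_grad [FiniteDimensional ℝ E] (g : RiemMetric E M) (W : M → ℝ) (q : M)
    (v : TangentSpace 𝓘(ℝ, E) q) :
    g.inner q (grad g W q) v = mfderiv 𝓘(ℝ, E) 𝓘(ℝ, ℝ) W q v :=
  congrArg (fun ℓ : E →L[ℝ] ℝ => ℓ v)
    (apply_inverse_of_pos (E := E) (g.inner q) (g.pos q) (mfderiv 𝓘(ℝ, E) 𝓘(ℝ, ℝ) W q))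

theorem metricInChart_christoffel [FiniteDimensional ℝ E] (g : RiemMetric E M) (p : M) {x : E}
    (hx : x ∈ (chartAt E p).target) (a b c : E) :
    metricInChart g p x (christoffel g p x a b) c =
      1 / 2 * (fderiv ℝ (metricInChart g p) x a b c + fderiv ℝ (metricInChart g p) x b a c
        - fderiv ℝ (metricInChart g p) x c a b) := by
  have hpos : ∀ v, v ≠ 0 → 0 < metricInChart g p x v v := by
    intro v hv
    have hq : (chartAt E p).symm x ∈
        (trivializationAt E (fun q : M => TangentSpace 𝓘(ℝ, E) q) p).baseSet := by
      simpa using (chartAt E p).map_target hx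
    refine g.pos _ _ fun h0 => hv ?_
    have h1 := (trivializationAt E (fun q : M => TangentSpace 𝓘(ℝ, E) q)
      p).continuousLinearMapAt_symmL (R := ℝ) hq v
    exact h1.symm.trans ((congrArg _ h0).trans (map_zero _))
  rw [christoffel, apply_inverse_of_pos _ hpos]
  simp [christoffelFirst]

end RobotControl

end

open Set Filter Topology MeasureTheory
open scoped Manifold ContDiff ENNReal

noncomputable section

namespace RobotControl

/-! ### Calculus of absolutely continuous functions given by an integral. -/

section ACDeriv

variable {V : Type*} [NormedAddCommGroup V] [NormedSpace ℝ V] {f f' F F' : ℝ → V} {a b c d : ℝ}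

/-! In the charts of `TM` the dynamics is a control-affine equation `z' = F(z) + G(z) u` with `C¹`
coefficients that match under changes of charts. `ControlSystem` keeps only this, and both claims
are proved for its `reachable` sets.

Compactness: take an ultrafilter on the pairs (control, trajectory in `K`). The controls are bounded
in `L²`, so they converge weakly, and convexity and closedness of `Ω` keep the limit a control
(`exists_isControl_weak_limit`). The trajectories converge pointwise because `K` is compact. Speeds
are locally bounded (`exists_nhds_forall_mem`), so the convergence is uniform in charts. As the
equation is affine in `u`, uniform convergence of the coefficients and weak convergence of the
controls suffice to pass to the limit in the integral equation (`solvesOn_of_tendsto`).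

Hausdorff continuity, for `s ≤ r` close together: a trajectory up to `r` restricts to `s`. A
trajectory up to `s` is prolonged by a constant control, for a time uniform over the compact `K`
(`exists_forall_exists_solvesOn`), and stays in `K` by assumption. In both cases the two end points
lie on one trajectory at nearby times, and trajectories through `K` are uniformly equicontinuous
(`exists_forall_edist_le`).

The passage from the manifold to `ControlSystem` rests on the transformation law of the Christoffel
symbols (`christoffel_transition`) and is completed by `isTrajectory_iff_solvesOn`. -/

theorem HasACDeriv.mono (h : HasACDeriv f F a b) (hac : a ≤ c) (hcd : c ≤ d) (hdb : d ≤ b) :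
    HasACDeriv f F c d := by
  have hab : a ≤ b := hac.trans (hcd.trans hdb)
  have hi : ∀ {s t : ℝ}, s ∈ Icc a b → t ∈ Icc a b → IntervalIntegrable F volume s t :=
    fun hs ht => h.1.mono_set (by rw [uIcc_of_le hab]; exact uIcc_subset_Icc hs ht)
  have ha : a ∈ Icc a b := ⟨le_rfl, hab⟩
  have hc : c ∈ Icc a b := ⟨hac, hcd.trans hdb⟩
  refine ⟨hi hc ⟨hac.trans hcd, hdb⟩, fun t ht => ?_⟩
  have ht' : t ∈ Icc a b := ⟨hac.trans ht.1, ht.2.trans hdb⟩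
  rw [h.2 t ht', h.2 c hc, add_assoc,
    intervalIntegral.integral_add_adjacent_intervals (hi ha hc) (hi hc ht')]

theorem HasACDeriv.trans (h₁ : HasACDeriv f F a b) (h₂ : HasACDeriv f F b c) (hab : a ≤ b)
    (hbc : b ≤ c) : HasACDeriv f F a c := by
  refine ⟨h₁.1.trans h₂.1, fun t ht => ?_⟩
  rcases le_total t b with htb | htb
  · exact h₁.2 t ⟨ht.1, htb⟩
  · have hbt : IntervalIntegrable F volume b t :=
      h₂.1.mono_set (by rw [uIcc_of_le hbc, uIcc_of_le htb]; exact Icc_subset_Icc_right ht.2)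
    rw [h₂.2 t ⟨htb, ht.2⟩, h₁.2 b ⟨hab, le_rfl⟩, add_assoc,
      intervalIntegral.integral_add_adjacent_intervals h₁.1 hbt]

theorem HasACDeriv.congr (h : HasACDeriv f F a b) (hab : a ≤ b) (hf : ∀ t ∈ Icc a b, f' t = f t)
    (hF : ∀ t ∈ Ioc a b, F' t = F t) : HasACDeriv f' F' a b := by
  refine ⟨h.1.congr fun t ht => (hF t (by rwa [uIoc_of_le hab] at ht)).symm, fun t ht => ?_⟩
  rw [hf t ht, hf a ⟨le_rfl, hab⟩, h.2 t ht]
  congr 1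
  refine intervalIntegral.integral_congr_ae (ae_of_all _ fun s hs => ?_)
  rw [uIoc_of_le ht.1] at hs
  exact (hF s ⟨hs.1, hs.2.trans ht.2⟩).symm

theorem hasACDeriv_of_hasDerivWithinAt [CompleteSpace V] (hab : a ≤ b)
    (h : ∀ t ∈ Icc a b, HasDerivWithinAt f (F t) (Icc a b) t) (hF : ContinuousOn F (Icc a b)) :
    HasACDeriv f F a b := by
  refine ⟨hF.intervalIntegrable_of_Icc hab, fun t ht => ?_⟩
  rw [intervalIntegral.integral_eq_sub_of_hasDeriv_right_of_le ht.1 (f := f)]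
  · abel
  · exact fun s hs => ((h s ⟨hs.1, hs.2.trans ht.2⟩).continuousWithinAt).mono
      (Icc_subset_Icc_right ht.2)
  · intro s hs
    exact ((h s ⟨hs.1.le, hs.2.le.trans ht.2⟩).hasDerivAt
      (Icc_mem_nhds hs.1 (hs.2.trans_le ht.2))).hasDerivWithinAt
  · exact (hF.mono (Icc_subset_Icc_right ht.2)).intervalIntegrable_of_Icc ht.1

theorem HasACDeriv.norm_sub_le (h : HasACDeriv f F a b) (hab : a ≤ b) {C : ℝ}
    (hC : ∀ᵐ s ∂(volume.restrict (Icc a b)), ‖F s‖ ≤ C) : ‖f b - f a‖ ≤ C * (b - a) := by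
  rw [h.2 b ⟨hab, le_rfl⟩, add_sub_cancel_left]
  have := intervalIntegral.norm_integral_le_of_norm_le_const_ae (a := a) (b := b) (f := F) (C := C)
    (by
      rw [ae_restrict_iff' measurableSet_Icc] at hC
      filter_upwards [hC] with s hs hs'
      rw [uIoc_of_le hab] at hs'
      exact hs (Ioc_subset_Icc_self hs'))
  rwa [abs_of_nonneg (sub_nonneg.2 hab)] at this

theorem HasACDeriv.prodMk {V' : Type*} [NormedAddCommGroup V'] [NormedSpace ℝ V']
    [CompleteSpace V] [CompleteSpace V']
    {g G : ℝ → V'} (hf : HasACDeriv f F a b) (hg : HasACDeriv g G a b) :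
    HasACDeriv (fun t => (f t, g t)) (fun t => (F t, G t)) a b := by
  have hint : IntervalIntegrable (fun t => (F t, G t)) volume a b := by
    rw [intervalIntegrable_iff] at *
    exact Integrable.prodMk (intervalIntegrable_iff.1 hf.1) (intervalIntegrable_iff.1 hg.1)
  refine ⟨hint, fun t ht => ?_⟩
  have hab : a ≤ b := ht.1.trans ht.2
  have hsub : uIoc a t ⊆ uIoc a b := by
    rw [uIoc_of_le ht.1, uIoc_of_le hab]; exact Ioc_subset_Ioc_right ht.2
  have h1 := (intervalIntegrable_iff.1 hf.1).mono_set hsub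
  have h2 := (intervalIntegrable_iff.1 hg.1).mono_set hsub
  beta_reduce
  rw [hf.2 t ht, hg.2 t ht, intervalIntegral.integral_of_le ht.1,
    intervalIntegral.integral_of_le ht.1, intervalIntegral.integral_of_le ht.1]
  rw [uIoc_of_le ht.1] at h1 h2
  rw [integral_pair h1 h2]
  rfl

theorem HasACDeriv.clm_comp {V' : Type*} [NormedAddCommGroup V'] [NormedSpace ℝ V']
    [CompleteSpace V] [CompleteSpace V']
    (hf : HasACDeriv f F a b) (L : V →L[ℝ] V') :
    HasACDeriv (fun t => L (f t)) (fun t => L (F t)) a b := by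
  refine ⟨?_, fun t ht => ?_⟩
  · exact ⟨L.integrable_comp hf.1.1, L.integrable_comp hf.1.2⟩
  · rw [L.intervalIntegral_comp_comm (hf.mono le_rfl ht.1 ht.2).1, ← map_add, ← hf.2 t ht]

end ACDeriv

/-! ### Continuity induction, ultrafilter compactness and continuous convergence. -/

section Topology

/-- Continuity induction: the times spent in `A` form a closed set, and being in `A` so far puts the
curve in the open set `O`, hence in `A` a little longer. It turns a speed bound valid only inside a
chart ball into confinement to that ball. -/
theorem forall_mem_Icc_of_continuousOn {X : Type*} [TopologicalSpace X] {f : ℝ → X} {a b : ℝ}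
    (hf : ContinuousOn f (Icc a b)) {A O : Set X} (hA : IsClosed A) (hO : IsOpen O) (hOA : O ⊆ A)
    (ha : f a ∈ A) (h : ∀ t ∈ Icc a b, (∀ s ∈ Icc a t, f s ∈ A) → f t ∈ O) :
    ∀ t ∈ Icc a b, f t ∈ O := by
  have hsub : Icc a b ⊆ f ⁻¹' A := by
    refine IsClosed.Icc_subset_of_forall_mem_nhdsGT_of_Icc_subset ?_ ha ?_
    · rw [inter_comm]
      exact hf.preimage_isClosed_of_isClosed isClosed_Icc hA
    · intro t ht hat
      have htO : f t ∈ O := h t ⟨ht.1, ht.2.le⟩ hat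
      have h1 : f ⁻¹' O ∈ 𝓝[Icc a b] t := hf t ⟨ht.1, ht.2.le⟩ (hO.mem_nhds htO)
      have h2 : 𝓝[>] t ≤ 𝓝[Icc a b] t := by
        rw [← nhdsWithin_Ioc_eq_nhdsGT ht.2]
        exact nhdsWithin_mono _ fun s hs => ⟨ht.1.trans hs.1.le, hs.2⟩
      exact mem_of_superset (h2 h1) (preimage_mono hOA)
  exact fun t ht => h t ht fun s hs => hsub ⟨hs.1, hs.2.trans ht.2⟩

theorem forall_mem_Icc_of_continuousOn' {X : Type*} [TopologicalSpace X] {f : ℝ → X} {a b : ℝ}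
    (hf : ContinuousOn f (Icc a b)) {A O : Set X} (hA : IsClosed A) (hO : IsOpen O) (hOA : O ⊆ A)
    (hb : f b ∈ A) (h : ∀ t ∈ Icc a b, (∀ s ∈ Icc t b, f s ∈ A) → f t ∈ O) :
    ∀ t ∈ Icc a b, f t ∈ O := by
  intro t ht
  have key := forall_mem_Icc_of_continuousOn (f := fun s => f (-s)) (a := -b) (b := -a)
    (hf.comp continuous_neg.continuousOn fun s hs => ⟨by linarith [hs.2], by linarith [hs.1]⟩)
    hA hO hOA (by simpa using hb) (fun s hs hs' => h (-s) ⟨by linarith [hs.2], by linarith [hs.1]⟩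
      fun r hr => by simpa using hs' (-r) ⟨by linarith [hr.2], by linarith [hr.1]⟩)
    (-t) ⟨by linarith [ht.2], by linarith [ht.1]⟩
  simpa using key

/-- An ultrafilter containing the range is the image of one on the index type, namely any
ultrafilter below its `comap`. Limits of all data carried by the index can then be taken along the
same ultrafilter. -/
theorem isCompact_range_of_ultrafilter {α X : Type*} [TopologicalSpace X] {e : α → X}
    (h : ∀ G : Ultrafilter α, ∃ x ∈ range e, Tendsto e G (𝓝 x)) : IsCompact (range e) := by
  rw [isCompact_iff_ultrafilter_le_nhds]
  intro F hF
  have hF' : range e ∈ F := le_principal_iff.1 hF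
  have hne : (comap e (F : Filter X)).NeBot := comap_neBot_iff_frequently.2
    (Filter.Eventually.frequently (by filter_upwards [hF'] with y hy; exact hy))
  obtain ⟨x, hx, hG⟩ := h (Ultrafilter.of (comap e (F : Filter X)))
  refine ⟨x, hx, ?_⟩
  have hle : map e (Ultrafilter.of (comap e (F : Filter X)) : Filter α) ≤ F :=
    map_le_iff_le_comap.2 (Ultrafilter.of_le _)
  have heq : (Ultrafilter.of (comap e (F : Filter X))).map e = F :=
    Ultrafilter.coe_le_coe.1 hle
  rw [← heq]
  exact hG

/-- Joint convergence in index and time is locally uniform, and on a compact set local uniformity is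
uniformity. -/
theorem tendstoUniformlyOn_of_forall_tendsto {α β Y : Type*} [TopologicalSpace β] [UniformSpace Y]
    {G : Filter α} {f : α → β → Y} {g : β → Y} {S : Set β} (hS : IsCompact S)
    (hg : ContinuousOn g S)
    (h : ∀ t ∈ S, Tendsto (fun p : α × β => f p.1 p.2) (G ×ˢ 𝓝[S] t) (𝓝 (g t))) :
    TendstoUniformlyOn f g G S := by
  rw [← tendstoLocallyUniformlyOn_iff_tendstoUniformlyOn_of_compact hS,
    tendstoLocallyUniformlyOn_iff_forall_tendsto]
  intro t ht
  have h1 : Tendsto (fun p : α × β => g p.2) (G ×ˢ 𝓝[S] t) (𝓝 (g t)) := Tendsto.comp (hg t ht) tendsto_snd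
  exact (h1.prodMk_nhds (h t ht)).mono_right (nhds_le_uniformity _)

theorem eventually_forall_mem_of_forall_tendsto {α β X : Type*} [TopologicalSpace β]
    [TopologicalSpace X] {G : Filter α} {f : α → β → X} {g : β → X} {S : Set β} (hS : IsCompact S)
    {O : Set X} (hO : IsOpen O) (hgO : ∀ t ∈ S, g t ∈ O)
    (h : ∀ t ∈ S, Tendsto (fun p : α × β => f p.1 p.2) (G ×ˢ 𝓝[S] t) (𝓝 (g t))) :
    ∀ᶠ x in G, ∀ t ∈ S, f x t ∈ O := by
  refine hS.induction_on (p := fun B => ∀ᶠ x in G, ∀ t ∈ B, f x t ∈ O) (by simp) ?_ ?_ ?_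
  · intro A B hAB hB
    filter_upwards [hB] with x hx t ht using hx t (hAB ht)
  · intro A B hA hB
    filter_upwards [hA, hB] with x hx hx' t ht using ht.elim (hx t) (hx' t)
  · intro t ht
    obtain ⟨A, hA, B, hB, hAB⟩ := mem_prod_iff.1 (h t ht (hO.mem_nhds (hgO t ht)))
    refine ⟨B, hB, ?_⟩
    filter_upwards [hA] with x hx s hs using hAB (mk_mem_prod hx hs)

end Topology

/-! ### Controls and their weak compactness. -/

section Control

variable {m : ℕ} {Ω : Set (EuclideanSpace ℝ (Fin m))} {T : ℝ}
  {u : ℝ → EuclideanSpace ℝ (Fin m)}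
  {V : Type*} [NormedAddCommGroup V] [NormedSpace ℝ V]

theorem isControl_of_aestronglyMeasurable (hΩ : Bornology.IsBounded Ω)
    (hu : AEStronglyMeasurable u (volume.restrict (Icc 0 T)))
    (h : ∀ᵐ t ∂(volume.restrict (Icc 0 T)), u t ∈ Ω) : IsControl Ω T u := by
  obtain ⟨R, hR⟩ := hΩ.exists_norm_le
  exact ⟨MemLp.of_bound hu R (h.mono fun t ht => hR _ ht), h⟩

theorem IsControl.mono (h : IsControl Ω T u) {T' : ℝ} (hT : T' ≤ T) : IsControl Ω T' u := by
  have hle : volume.restrict (Icc 0 T') ≤ volume.restrict (Icc 0 T) :=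
    Measure.restrict_mono (Icc_subset_Icc_right hT) le_rfl
  exact ⟨h.1.mono_measure hle, ae_mono hle h.2⟩

theorem IsControl.ae_mem_Icc (h : IsControl Ω T u) {a b : ℝ} (ha : 0 ≤ a) (hb : b ≤ T) :
    ∀ᵐ t ∂(volume.restrict (Icc a b)), u t ∈ Ω :=
  ae_mono (Measure.restrict_mono (Icc_subset_Icc ha hb) le_rfl) h.2

theorem IsControl.extend (hΩ : Bornology.IsBounded Ω) (h : IsControl Ω T u)
    {u₀ : EuclideanSpace ℝ (Fin m)} (hu₀ : u₀ ∈ Ω) (T' : ℝ) :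
    IsControl Ω T' (fun t => if t ≤ T then u t else u₀) := by
  have hset : Icc 0 T' ∩ Iic T ⊆ Icc 0 T := fun t ht => ⟨ht.1.1, ht.2⟩
  have hle : (volume.restrict (Icc 0 T')).restrict (Iic T) ≤ volume.restrict (Icc 0 T) := by
    rw [Measure.restrict_restrict measurableSet_Iic, inter_comm]
    exact Measure.restrict_mono hset le_rfl
  refine isControl_of_aestronglyMeasurable hΩ ?_ ?_
  · have := AEStronglyMeasurable.piecewise (μ := volume.restrict (Icc 0 T')) (s := Iic T)
      (f := u) (g := fun _ => u₀) measurableSet_Iic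
      (h.1.aestronglyMeasurable.mono_measure hle) aestronglyMeasurable_const
    exact this
  · have h1 : ∀ᵐ t ∂((volume.restrict (Icc 0 T')).restrict (Iic T)), u t ∈ Ω := ae_mono hle h.2
    rw [ae_restrict_iff' measurableSet_Iic] at h1
    filter_upwards [h1] with t ht
    split_ifs with h2
    · exact ht h2
    · exact hu₀

theorem IsControl.integrableOn_clm (h : IsControl Ω T u) (hΩ : Bornology.IsBounded Ω) {a b : ℝ}
    (ha : 0 ≤ a) (hb : b ≤ T) {L : ℝ → EuclideanSpace ℝ (Fin m) →L[ℝ] V}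
    (hL : ContinuousOn L (Icc a b)) : IntegrableOn (fun t => L t (u t)) (Icc a b) := by
  obtain ⟨R, hR⟩ := hΩ.exists_norm_le
  obtain ⟨C, hC⟩ := isCompact_Icc.exists_bound_of_continuousOn hL
  have hum : AEStronglyMeasurable u (volume.restrict (Icc a b)) :=
    h.1.aestronglyMeasurable.mono_measure (Measure.restrict_mono (Icc_subset_Icc ha hb) le_rfl)
  have hLm : AEStronglyMeasurable L (volume.restrict (Icc a b)) :=
    hL.aestronglyMeasurable measurableSet_Icc
  refine Integrable.of_bound
    (isBoundedBilinearMap_apply.continuous.comp_aestronglyMeasurable (hLm.prodMk hum)) (C * R) ?_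
  filter_upwards [h.ae_mem_Icc ha hb, ae_restrict_mem measurableSet_Icc] with t ht ht'
  exact ((L t).le_opNorm _).trans (mul_le_mul (hC t ht') (hR _ ht) (norm_nonneg _)
    ((norm_nonneg _).trans (hC t ht')))

theorem IsControl.intervalIntegrable_clm (h : IsControl Ω T u) (hΩ : Bornology.IsBounded Ω)
    {a b : ℝ} (ha : 0 ≤ a) (hab : a ≤ b) (hb : b ≤ T)
    {L : ℝ → EuclideanSpace ℝ (Fin m) →L[ℝ] V} (hL : ContinuousOn L (Icc a b)) :
    IntervalIntegrable (fun t => L t (u t)) volume a b := by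
  rw [intervalIntegrable_iff_integrableOn_Icc_of_le hab]
  exact h.integrableOn_clm hΩ ha hb hL

/-- Weak convergence of controls, tested against continuous operator-valued functions. -/
def WeaklyTendsto {α : Type*} (T : ℝ) (u : α → ℝ → EuclideanSpace ℝ (Fin m)) (G : Filter α)
    (w : ℝ → EuclideanSpace ℝ (Fin m)) (V : Type*) [NormedAddCommGroup V] [NormedSpace ℝ V] :
    Prop :=
  ∀ a b, 0 ≤ a → a ≤ b → b ≤ T → ∀ L : ℝ → EuclideanSpace ℝ (Fin m) →L[ℝ] V,
    ContinuousOn L (Icc a b) →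
    Tendsto (fun x => ∫ s in a..b, L s (u x s)) G (𝓝 (∫ s in a..b, L s (w s)))

/-- Banach–Alaoglu in the Hilbert space `L²`, whose dual is identified with the space itself by
Riesz. -/
theorem exists_weak_limit {α : Type*} (G : Ultrafilter α) (hΩ : Bornology.IsBounded Ω)
    {u : α → ℝ → EuclideanSpace ℝ (Fin m)} (hu : ∀ x, IsControl Ω T (u x)) :
    ∃ w : ℝ → EuclideanSpace ℝ (Fin m), MemLp w 2 (volume.restrict (Icc 0 T)) ∧
      WeaklyTendsto T u (G : Filter α) w ℝ := by
  set H := Lp (EuclideanSpace ℝ (Fin m)) 2 (volume.restrict (Icc 0 T)) with hH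
  obtain ⟨R, hR⟩ := hΩ.exists_norm_le
  let U : α → H := fun x => (hu x).1.toLp
  obtain ⟨B, hB⟩ : ∃ B : ℝ, ∀ x, ‖U x‖ ≤ B := by
    refine ⟨_, fun x => Lp.norm_le_of_ae_bound (C := max R 0) (le_max_right _ _) ?_⟩
    filter_upwards [(hu x).2, (hu x).1.coeFn_toLp] with t ht ht'
    rw [ht']
    exact (hR _ ht).trans (le_max_left _ _)
  let ℓ : α → WeakDual ℝ H := fun x => StrongDual.toWeakDual (InnerProductSpace.toDual ℝ H (U x))
  obtain ⟨ℓ₀, -, hℓ₀⟩ := (WeakDual.isCompact_closedBall (𝕜 := ℝ) (E := H) 0 B).ultrafilter_le_nhds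
    (G.map ℓ) (by
      refine le_principal_iff.2 (mem_map.2 (Filter.univ_mem' fun x => ?_))
      simp only [mem_preimage, mem_closedBall_zero_iff]
      exact (LinearIsometryEquiv.norm_map (InnerProductSpace.toDual ℝ H) (U x)).trans_le (hB x))
  let w : H := (InnerProductSpace.toDual ℝ H).symm (WeakDual.toStrongDual ℓ₀)
  have hconv : ∀ y : H, Tendsto (fun x => inner ℝ (U x) y) G (𝓝 (inner ℝ w y)) := by
    intro y
    have h1 : Tendsto (fun x => ℓ x y) G (𝓝 (ℓ₀ y)) :=
      ((WeakDual.eval_continuous y).tendsto ℓ₀).comp hℓ₀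
    have h2 : inner ℝ w y = ℓ₀ y := by
      rw [← InnerProductSpace.toDual_apply_apply (𝕜 := ℝ), LinearIsometryEquiv.apply_symm_apply]
      rfl
    rw [h2]
    exact h1
  refine ⟨w, Lp.memLp w, fun a b ha hab hb L hL => ?_⟩
  -- The Riesz representative of `L s`, cut off outside `[a, b]`: its inner product with a control
  -- in `L²` is the integral to be tested.
  let Y : ℝ → EuclideanSpace ℝ (Fin m) := (Icc a b).indicator fun s =>
    (InnerProductSpace.toDual ℝ (EuclideanSpace ℝ (Fin m))).symm (L s)
  have hYc : ContinuousOn (fun s =>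
    (InnerProductSpace.toDual ℝ (EuclideanSpace ℝ (Fin m))).symm (L s)) (Icc a b) :=
    (LinearIsometryEquiv.continuous _).comp_continuousOn hL
  have hY : MemLp Y 2 (volume.restrict (Icc 0 T)) := by
    rw [memLp_indicator_iff_restrict measurableSet_Icc,
      Measure.restrict_restrict measurableSet_Icc,
      inter_eq_self_of_subset_left (Icc_subset_Icc ha hb)]
    obtain ⟨C, hC⟩ := isCompact_Icc.exists_bound_of_continuousOn hYc
    exact MemLp.of_bound (hYc.aestronglyMeasurable measurableSet_Icc) C
      ((ae_restrict_mem measurableSet_Icc).mono fun t ht => hC t ht)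
  have hval : ∀ (v : H) (v' : ℝ → EuclideanSpace ℝ (Fin m)),
      v =ᵐ[volume.restrict (Icc 0 T)] v' →
      inner ℝ v hY.toLp = ∫ s in a..b, L s (v' s) := by
    intro v v' hv
    rw [L2.inner_def, intervalIntegral.integral_of_le hab, ← integral_Icc_eq_integral_Ioc]
    have h1 : ∫ s in Icc a b, L s (v' s) =
        ∫ s in Icc 0 T, (Icc a b).indicator (fun s => L s (v' s)) s := by
      rw [integral_indicator measurableSet_Icc, Measure.restrict_restrict measurableSet_Icc,
        inter_eq_self_of_subset_left (Icc_subset_Icc ha hb)]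
    rw [h1]
    refine integral_congr_ae ?_
    filter_upwards [hv, hY.coeFn_toLp] with s hs hs'
    rw [hs, hs']
    by_cases hsab : s ∈ Icc a b
    · simp only [Y, indicator_of_mem hsab]
      rw [real_inner_comm, ← InnerProductSpace.toDual_apply_apply (𝕜 := ℝ),
        LinearIsometryEquiv.apply_symm_apply]
    · simp [Y, indicator_of_notMem hsab]
  rw [← hval w w (ae_eq_refl _)]
  refine (hconv hY.toLp).congr fun x => hval _ _ (hu x).1.coeFn_toLp

theorem WeaklyTendsto.of_real {α : Type*} {G : Filter α}
    {u : α → ℝ → EuclideanSpace ℝ (Fin m)} {w : ℝ → EuclideanSpace ℝ (Fin m)}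
    (h : WeaklyTendsto T u G w ℝ)
    (hu : ∀ x a b, 0 ≤ a → a ≤ b → b ≤ T → ∀ L : ℝ → EuclideanSpace ℝ (Fin m) →L[ℝ] V,
      ContinuousOn L (Icc a b) → IntervalIntegrable (fun t => L t (u x t)) volume a b)
    (hw : ∀ a b, 0 ≤ a → a ≤ b → b ≤ T → ∀ L : ℝ → EuclideanSpace ℝ (Fin m) →L[ℝ] V,
      ContinuousOn L (Icc a b) → IntervalIntegrable (fun t => L t (w t)) volume a b)
    [FiniteDimensional ℝ V] :
    WeaklyTendsto T u G w V := by
  intro a b ha hab hb L hL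
  have : CompleteSpace V := FiniteDimensional.complete ℝ V
  let e : V ≃L[ℝ] (Fin (Module.finrank ℝ V) → ℝ) := (Module.finBasis ℝ V).equivFunL
  suffices hs : Tendsto (fun x => e (∫ s in a..b, L s (u x s))) G
      (𝓝 (e (∫ s in a..b, L s (w s)))) by
    have := (e.symm.continuous.tendsto _).comp hs
    simpa [Function.comp_def] using this
  rw [tendsto_pi_nhds]
  intro k
  let p : V →L[ℝ] ℝ := 
    (ContinuousLinearMap.proj (R := ℝ) (φ := fun _ => ℝ) k).comp
      (e : V →L[ℝ] (Fin (Module.finrank ℝ V) → ℝ))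
  have hp : ∀ v : ℝ → EuclideanSpace ℝ (Fin m),
      IntervalIntegrable (fun s => L s (v s)) volume a b →
      e (∫ s in a..b, L s (v s)) k = ∫ s in a..b, (p.comp (L s)) (v s) := fun v hv =>
    (p.intervalIntegral_comp_comm hv).symm
  rw [hp w (hw a b ha hab hb L hL)]
  refine (h a b ha hab hb (fun s => p.comp (L s)) ?_).congr
    fun x => (hp _ (hu x a b ha hab hb L hL)).symm
  exact (ContinuousLinearMap.compL ℝ _ V ℝ p).continuous.comp_continuousOn hL

theorem intervalIntegrable_clm_of_memLp {w : ℝ → EuclideanSpace ℝ (Fin m)}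
    (hw : MemLp w 2 (volume.restrict (Icc 0 T))) {a b : ℝ} (ha : 0 ≤ a) (hab : a ≤ b) (hb : b ≤ T)
    {L : ℝ → EuclideanSpace ℝ (Fin m) →L[ℝ] V} (hL : ContinuousOn L (Icc a b)) :
    IntervalIntegrable (fun t => L t (w t)) volume a b := by
  rw [intervalIntegrable_iff_integrableOn_Icc_of_le hab]
  have hw1 : Integrable w (volume.restrict (Icc a b)) :=
    (hw.mono_measure (Measure.restrict_mono (Icc_subset_Icc ha hb) le_rfl)).integrable (by norm_num)
  obtain ⟨C, hC⟩ := isCompact_Icc.exists_bound_of_continuousOn hL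
  have hLm : AEStronglyMeasurable L (volume.restrict (Icc a b)) :=
    hL.aestronglyMeasurable measurableSet_Icc
  refine Integrable.mono' (hw1.norm.const_mul C)
    (isBoundedBilinearMap_apply.continuous.comp_aestronglyMeasurable (hLm.prodMk hw1.1)) ?_
  filter_upwards [ae_restrict_mem measurableSet_Icc] with t ht
  exact ((L t).le_opNorm _).trans (mul_le_mul_of_nonneg_right (hC t ht) (norm_nonneg _))

/-- The controls with values in a compact convex set are weakly compact. -/
theorem exists_isControl_weak_limit {α : Type*} (G : Ultrafilter α) (hΩ : IsCompact Ω)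
    (hΩc : Convex ℝ Ω) (hT : 0 ≤ T)
    {u : α → ℝ → EuclideanSpace ℝ (Fin m)} (hu : ∀ x, IsControl Ω T (u x))
    (V : Type*) [NormedAddCommGroup V] [NormedSpace ℝ V] [FiniteDimensional ℝ V] :
    ∃ w : ℝ → EuclideanSpace ℝ (Fin m), IsControl Ω T w ∧ WeaklyTendsto T u (G : Filter α) w V := by
  obtain ⟨w, hw, hlim⟩ := exists_weak_limit G hΩ.isBounded hu
  refine ⟨w, ⟨hw, ?_⟩, hlim.of_real
    (fun x a b ha hab hb L hL => (hu x).intervalIntegrable_clm hΩ.isBounded ha hab hb hL)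
    (fun a b ha hab hb L hL => intervalIntegrable_clm_of_memLp hw ha hab hb hL)⟩
  have hint : ∀ {a b}, 0 ≤ a → a ≤ b → b ≤ T → IntervalIntegrable w volume a b :=
    fun ha hab hb => intervalIntegrable_clm_of_memLp hw ha hab hb
      (L := fun _ => ContinuousLinearMap.id ℝ _) continuousOn_const
  have hid : WeaklyTendsto T u (G : Filter α) w (EuclideanSpace ℝ (Fin m)) := hlim.of_real
    (fun x a b ha hab hb L hL => (hu x).intervalIntegrable_clm hΩ.isBounded ha hab hb hL)
    (fun a b ha hab hb L hL => intervalIntegrable_clm_of_memLp hw ha hab hb hL)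
  -- Averages of the controls lie in the closed convex set `Ω`, and weak convergence carries this
  -- over to averages of `w`. Lebesgue differentiation then gives `w t ∈ Ω` almost everywhere.
  have hslope : ∀ a b, 0 ≤ a → a < b → b ≤ T → (b - a)⁻¹ • ∫ s in a..b, w s ∈ Ω := by
    intro a b ha hab hb
    have hconv := (hid a b ha hab.le hb (fun _ => ContinuousLinearMap.id ℝ _)
      continuousOn_const).const_smul (b - a)⁻¹
    refine hΩ.isClosed.mem_of_tendsto hconv (Eventually.of_forall fun x => ?_)
    have hx : ∀ᵐ t ∂(volume.restrict (Icc a b)), u x t ∈ Ω := (hu x).ae_mem_Icc ha hb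
    have := hΩc.set_average_mem hΩ.isClosed (μ := volume) (t := Icc a b) (f := u x)
      (by simp [hab]) (by simp) hx ((hu x).integrableOn_clm hΩ.isBounded ha hb
        (L := fun _ => ContinuousLinearMap.id ℝ _) continuousOn_const)
    rw [setAverage_eq, Measure.real, Real.volume_Icc,
      ENNReal.toReal_ofReal (sub_nonneg.2 hab.le)] at this
    rw [intervalIntegral.integral_of_le hab.le, ← integral_Icc_eq_integral_Ioc]
    exact this
  have hder := (hint le_rfl hT le_rfl).ae_hasDerivAt_integral
  rw [ae_restrict_iff' measurableSet_Icc]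
  -- The end point is discarded because the averages are taken to the right of `t`.
  have hne : ∀ᵐ t : ℝ, t ≠ T := by simp [ae_iff]
  filter_upwards [hder, hne] with t ht htT ht'
  have h0 : (0 : ℝ) ∈ uIcc 0 T := left_mem_uIcc
  have hd := (ht (by rwa [uIcc_of_le hT]) 0 h0)
  have htlt : t < T := lt_of_le_of_ne ht'.2 htT
  have hs : Tendsto (slope (fun x => ∫ s in (0 : ℝ)..x, w s) t) (𝓝[>] t) (𝓝 (w t)) :=
    (hasDerivAt_iff_tendsto_slope.1 hd).mono_left (nhdsWithin_mono _ fun s hs => ne_of_gt hs)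
  refine hΩ.isClosed.mem_of_tendsto hs ?_
  filter_upwards [Ioc_mem_nhdsGT htlt] with s hs
  have := hslope t s ht'.1 hs.1 hs.2
  rwa [slope_def_module, intervalIntegral.integral_interval_sub_left
    (hint le_rfl (ht'.1.trans hs.1.le) hs.2) (hint le_rfl ht'.1 ht'.2)]

end Control

/-! ### Control-affine systems on a space with charts. -/

/-- A control-affine system `z' = F(z) + G(z) u` on a space `X` with charts in `V`, given by its
expressions in the charts. -/
structure ControlSystem (ι X V U : Type*) [TopologicalSpace X] [NormedAddCommGroup V]
    [NormedSpace ℝ V] [NormedAddCommGroup U] [NormedSpace ℝ U] where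
  chart : ι → OpenPartialHomeomorph X V
  drift : ι → V → V
  ctrl : ι → V → U →L[ℝ] V
  exists_mem_source : ∀ x, ∃ i, x ∈ (chart i).source
  contDiffAt_drift : ∀ i, ∀ z ∈ (chart i).target, ContDiffAt ℝ 1 (drift i) z
  contDiffAt_ctrl : ∀ i, ∀ z ∈ (chart i).target, ContDiffAt ℝ 1 (ctrl i) z
  -- Serves existence only: a solution built in one chart must solve the system in all others.
  -- Limits of trajectories are treated in each chart separately.
  compat : ∀ i j, ∀ z ∈ (chart i).target, (chart i).symm z ∈ (chart j).source →
    ∃ D : V →L[ℝ] V, HasFDerivAt (chart j ∘ (chart i).symm) D z ∧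
      ∀ u, D (drift i z + ctrl i z u) =
        drift j (chart j ((chart i).symm z)) + ctrl j (chart j ((chart i).symm z)) u

namespace ControlSystem

section Basic

variable {ι X V U : Type*} [TopologicalSpace X] [NormedAddCommGroup V]
    [NormedSpace ℝ V] [NormedAddCommGroup U] [NormedSpace ℝ U] (S : ControlSystem ι X V U)

/-- The velocity of the system in the chart `i`. -/
def rhs (i : ι) (z : V) (u : U) : V := S.drift i z + S.ctrl i z u

/-- The curve `γ` solves the system on `[c, d]`. -/
def SolvesOn (c d : ℝ) (u : ℝ → U) (γ : ℝ → X) : Prop :=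
  ContinuousOn γ (Icc c d) ∧
  ∀ i a b, c ≤ a → a ≤ b → b ≤ d → (∀ t ∈ Icc a b, γ t ∈ (S.chart i).source) →
    HasACDeriv (fun t => S.chart i (γ t)) (fun t => S.rhs i (S.chart i (γ t)) (u t)) a b

variable {S} {c d e : ℝ} {u u' : ℝ → U} {γ γ' : ℝ → X}

theorem SolvesOn.mono (h : S.SolvesOn c d u γ) {c' d' : ℝ} (hc : c ≤ c') (hd : d' ≤ d) :
    S.SolvesOn c' d' u γ :=
  ⟨h.1.mono (Icc_subset_Icc hc hd), fun i a b ha hab hb => h.2 i a b (hc.trans ha) hab (hb.trans hd)⟩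

theorem SolvesOn.trans (h₁ : S.SolvesOn c d u γ) (h₂ : S.SolvesOn d e u γ) (hcd : c ≤ d)
    (hde : d ≤ e) : S.SolvesOn c e u γ := by
  refine ⟨?_, fun i a b ha hab hb hs => ?_⟩
  · rw [← Icc_union_Icc_eq_Icc hcd hde]
    exact h₁.1.union_of_isClosed h₂.1 isClosed_Icc isClosed_Icc
  · rcases le_total b d with hbd | hbd
    · exact h₁.2 i a b ha hab hbd hs
    rcases le_total d a with hda | hda
    · exact h₂.2 i a b hda hab hb hs
    · exact (h₁.2 i a d ha hda le_rfl fun t ht => hs t ⟨ht.1, ht.2.trans hbd⟩).trans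
        (h₂.2 i d b le_rfl hbd hb fun t ht => hs t ⟨hda.trans ht.1, ht.2⟩) hda hbd

/-- The controls are compared on `Ioc c d` only: at the junction time `c` a pasted control still has
its earlier value. -/
theorem SolvesOn.congr (h : S.SolvesOn c d u γ) (hγ : ∀ t ∈ Icc c d, γ' t = γ t)
    (hu : ∀ t ∈ Ioc c d, u' t = u t) : S.SolvesOn c d u' γ' := by
  refine ⟨h.1.congr hγ, fun i a b ha hab hb hs => ?_⟩
  have hm : ∀ t ∈ Icc a b, t ∈ Icc c d := fun t ht => ⟨ha.trans ht.1, ht.2.trans hb⟩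
  refine (h.2 i a b ha hab hb fun t ht => hγ t (hm t ht) ▸ hs t ht).congr hab
    (fun t ht => by rw [hγ t (hm t ht)]) fun t ht => ?_
  rw [hγ t (hm t (Ioc_subset_Icc_self ht)), hu t ⟨ha.trans_lt ht.1, ht.2.trans hb⟩]

variable (S)

/-- The closed ball is compact, so its image in the Hausdorff space `X` is closed in `X` and not
merely in the chart domain. Continuity induction needs this. -/
theorem exists_closedBall [T2Space X] [ProperSpace V] {x : X} {N : Set X} (hN : N ∈ 𝓝 x) :
    ∃ i, x ∈ (S.chart i).source ∧ ∃ r > 0,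
      Metric.closedBall (S.chart i x) r ⊆ (S.chart i).target ∧
      (S.chart i).symm '' Metric.closedBall (S.chart i x) r ⊆ N ∧
      IsClosed ((S.chart i).symm '' Metric.closedBall (S.chart i x) r) := by
  obtain ⟨i, hi⟩ := S.exists_mem_source x
  have hz : S.chart i x ∈ (S.chart i).target := (S.chart i).map_source hi
  have h1 : (S.chart i).target ∩ (S.chart i).symm ⁻¹' N ∈ 𝓝 (S.chart i x) := by
    refine inter_mem ((S.chart i).open_target.mem_nhds hz) ?_
    refine (S.chart i).continuousAt_symm hz ?_
    rwa [(S.chart i).left_inv hi]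
  obtain ⟨r, hr, hsub⟩ := Metric.nhds_basis_closedBall.mem_iff.1 h1
  have ht : Metric.closedBall (S.chart i x) r ⊆ (S.chart i).target := fun z hz => (hsub hz).1
  refine ⟨i, hi, r, hr, ht, ?_, ?_⟩
  · rintro _ ⟨z, hz, rfl⟩
    exact (hsub hz).2
  · exact ((isCompact_closedBall _ _).image_of_continuousOn
      ((S.chart i).continuousOn_symm.mono ht)).isClosed

theorem regularSpace (S : ControlSystem ι X V U) [T2Space X] [ProperSpace V] : RegularSpace X := by
  refine RegularSpace.of_exists_mem_nhds_isClosed_subset fun x N hN => ?_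
  obtain ⟨i, hi, r, hr, ht, hN', hcl⟩ := S.exists_closedBall hN
  refine ⟨_, ?_, hcl, hN'⟩
  have h1 : (S.chart i).source ∩ S.chart i ⁻¹' Metric.ball (S.chart i x) r ∈ 𝓝 x :=
    ((S.chart i).isOpen_inter_preimage Metric.isOpen_ball).mem_nhds
      ⟨hi, Metric.mem_ball_self hr⟩
  refine mem_of_superset h1 fun y hy => ⟨_, Metric.ball_subset_closedBall hy.2, ?_⟩
  exact (S.chart i).left_inv hy.1

theorem continuousOn_drift (i : ι) : ContinuousOn (S.drift i) (S.chart i).target :=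
  fun z hz => (S.contDiffAt_drift i z hz).continuousAt.continuousWithinAt

theorem continuousOn_ctrl (i : ι) : ContinuousOn (S.ctrl i) (S.chart i).target :=
  fun z hz => (S.contDiffAt_ctrl i z hz).continuousAt.continuousWithinAt

theorem continuousOn_rhs (i : ι) :
    ContinuousOn (fun p : V × U => S.rhs i p.1 p.2) ((S.chart i).target ×ˢ univ) := by
  have hfst : MapsTo (Prod.fst : V × U → V) ((S.chart i).target ×ˢ univ) (S.chart i).target :=
    fun p hp => hp.1
  exact ((S.continuousOn_drift i).comp continuous_fst.continuousOn hfst).add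
    (((S.continuousOn_ctrl i).comp continuous_fst.continuousOn hfst).clm_apply
      continuous_snd.continuousOn)

end Basic

/-! ### Confinement of trajectories, their limits, compactness of reachable sets. -/

section Controlled

variable {ι X V : Type*} [TopologicalSpace X] [NormedAddCommGroup V] [NormedSpace ℝ V] {m : ℕ}
  (S : ControlSystem ι X V (EuclideanSpace ℝ (Fin m))) {Ω : Set (EuclideanSpace ℝ (Fin m))}

/-- Trajectories leave a neighbourhood of a point at the earliest after a time that depends on the
neighbourhood only. -/
theorem exists_nhds_forall_mem [T2Space X] [ProperSpace V] (hΩ : IsCompact Ω) {x : X} {N : Set X}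
    (hN : N ∈ 𝓝 x) :
    ∃ A ∈ 𝓝 x, ∃ δ > 0, ∀ T u γ, IsControl Ω T u → S.SolvesOn 0 T u γ →
      ∀ a ∈ Icc 0 T, γ a ∈ A → ∀ t ∈ Icc 0 T, |t - a| ≤ δ → γ t ∈ N := by
  obtain ⟨i, hi, r, hr, ht, hN', hcl⟩ := S.exists_closedBall hN
  set φ := S.chart i with hφ
  set W := φ.symm '' Metric.closedBall (φ x) r with hW
  obtain ⟨C, hC⟩ := ((isCompact_closedBall (φ x) r).prod hΩ).exists_bound_of_continuousOn
    ((S.continuousOn_rhs i).mono (prod_mono ht (subset_univ _)))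
  have hWs : W ⊆ φ.source := by
    rintro _ ⟨z, hz, rfl⟩
    exact φ.map_target (ht hz)
  have hWb : ∀ y ∈ W, φ y ∈ Metric.closedBall (φ x) r := by
    rintro _ ⟨z, hz, rfl⟩
    rwa [φ.right_inv (ht hz)]
  set O := φ.source ∩ φ ⁻¹' Metric.ball (φ x) r with hO
  have hOo : IsOpen O := φ.isOpen_inter_preimage Metric.isOpen_ball
  have hOW : O ⊆ W := fun y hy => ⟨_, Metric.ball_subset_closedBall hy.2, φ.left_inv hy.1⟩
  have hC0 : 0 < |C| + 1 := by positivity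
  -- Start in the half ball: at speed at most `|C| + 1` the curve moves by at most `r / 2` in the
  -- time `r / 2 / (|C| + 1)`, so it remains in the open ball of radius `r`.
  refine ⟨φ.source ∩ φ ⁻¹' Metric.ball (φ x) (r / 2),
    (φ.isOpen_inter_preimage Metric.isOpen_ball).mem_nhds ⟨hi, Metric.mem_ball_self (half_pos hr)⟩,
    r / 2 / (|C| + 1), by positivity, ?_⟩
  intro T u γ hu hγ a ha haA t htT htδ
  have est : ∀ s t, 0 ≤ s → s ≤ t → t ≤ T → t - s ≤ r / 2 / (|C| + 1) →
      (∀ q ∈ Icc s t, γ q ∈ W) → dist (φ (γ t)) (φ (γ s)) ≤ r / 2 := by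
    intro s t hs hst htT hδ hq
    have h1 := (hγ.2 i s t hs hst htT fun q hq' => hWs (hq q hq')).norm_sub_le hst (C := |C| + 1) (by
      filter_upwards [hu.ae_mem_Icc hs htT, ae_restrict_mem measurableSet_Icc] with q hq1 hq2
      exact ((hC (φ (γ q), u q) ⟨hWb _ (hq q hq2), hq1⟩).trans (le_abs_self C)).trans
        (lt_add_one _).le)
    rw [dist_eq_norm]
    refine h1.trans ?_
    rw [le_div_iff₀ hC0] at hδ
    linarith
  have haO : γ a ∈ W := hOW ⟨haA.1, Metric.ball_subset_ball (half_le_self hr.le) haA.2⟩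
  have haA2 : dist (φ (γ a)) (φ x) < r / 2 := haA.2
  rcases le_total a t with hat | hat
  · rw [abs_of_nonneg (sub_nonneg.2 hat)] at htδ
    refine hN' (hOW (forall_mem_Icc_of_continuousOn (hγ.1.mono (Icc_subset_Icc ha.1 htT.2)) hcl hOo
      hOW haO ?_ t ⟨hat, le_rfl⟩))
    intro s hs hq
    have h1 := est a s ha.1 hs.1 (hs.2.trans htT.2) (by linarith [hs.2]) hq
    refine ⟨hWs (hq s ⟨hs.1, le_rfl⟩), ?_⟩
    exact (dist_triangle _ (φ (γ a)) _).trans_lt (by linarith)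
  · rw [abs_sub_comm, abs_of_nonneg (sub_nonneg.2 hat)] at htδ
    refine hN' (hOW (forall_mem_Icc_of_continuousOn' (hγ.1.mono (Icc_subset_Icc htT.1 ha.2)) hcl hOo
      hOW haO ?_ t ⟨le_rfl, hat⟩))
    intro s hs hq
    have h1 := est s a (htT.1.trans hs.1) hs.2 ha.2 (by linarith [hs.1]) hq
    refine ⟨hWs (hq s ⟨le_rfl, hs.2⟩), ?_⟩
    rw [dist_comm] at h1
    exact (dist_triangle _ (φ (γ a)) _).trans_lt (by linarith)

/-- A pointwise limit of trajectories whose controls converge weakly is a trajectory. -/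
theorem solvesOn_of_tendsto [T2Space X] [FiniteDimensional ℝ V] (hΩ : IsCompact Ω) {α : Type*}
    {G : Filter α} [G.NeBot] {T : ℝ} {u : α → ℝ → EuclideanSpace ℝ (Fin m)} {γ : α → ℝ → X}
    (hu : ∀ x, IsControl Ω T (u x)) (hγ : ∀ x, S.SolvesOn 0 T (u x) (γ x))
    {w : ℝ → EuclideanSpace ℝ (Fin m)} {σ : ℝ → X} (hw : IsControl Ω T w)
    (huw : WeaklyTendsto T u G w V)
    (hγσ : ∀ t ∈ Icc 0 T, Tendsto (fun x => γ x t) G (𝓝 (σ t))) : S.SolvesOn 0 T w σ := by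
  have : ProperSpace V := FiniteDimensional.proper ℝ V
  have : CompleteSpace V := FiniteDimensional.complete ℝ V
  have : RegularSpace X := S.regularSpace
  -- Confinement upgrades pointwise convergence to joint convergence in index and time.
  have hcc : ∀ t ∈ Icc 0 T,
      Tendsto (fun p : α × ℝ => γ p.1 p.2) (G ×ˢ 𝓝[Icc 0 T] t) (𝓝 (σ t)) := by
    intro t ht N hN
    obtain ⟨A, hA, δ, hδ, h⟩ := S.exists_nhds_forall_mem hΩ hN
    refine mem_map.2 (mem_prod_iff.2 ⟨{x | γ x t ∈ A}, hγσ t ht hA,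
      Icc 0 T ∩ Metric.closedBall t δ, inter_mem_nhdsWithin _ (Metric.closedBall_mem_nhds t hδ), ?_⟩)
    rintro ⟨x, s⟩ ⟨hx, hs⟩
    exact h T (u x) (γ x) (hu x) (hγ x) t ht hx s hs.1 (by simpa [Real.dist_eq] using hs.2)
  have hσc : ContinuousOn σ (Icc 0 T) := by
    intro t ht
    refine (closed_nhds_basis (σ t)).ge_iff.2 fun N hN => ?_
    obtain ⟨A, hA, B, hB, hAB⟩ := mem_prod_iff.1 (hcc t ht hN.1)
    refine mem_map.2 (mem_of_superset (inter_mem hB self_mem_nhdsWithin) fun s hs => ?_)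
    refine hN.2.mem_of_tendsto (hγσ s hs.2) ?_
    filter_upwards [hA] with x hx using hAB (mk_mem_prod hx hs.1)
  refine ⟨hσc, fun i a b ha hab hb hs => ?_⟩
  set φ := S.chart i with hφ
  have hsub : Icc a b ⊆ Icc 0 T := Icc_subset_Icc ha hb
  have hccab : ∀ t ∈ Icc a b,
      Tendsto (fun p : α × ℝ => γ p.1 p.2) (G ×ˢ 𝓝[Icc a b] t) (𝓝 (σ t)) := fun t ht =>
    (hcc t (hsub ht)).mono_left (prod_mono_right _ (nhdsWithin_mono _ hsub))
  have hsrc := eventually_forall_mem_of_forall_tendsto isCompact_Icc φ.open_source hs hccab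
  have hzt : ∀ t ∈ Icc a b, φ (σ t) ∈ φ.target := fun t ht => φ.map_source (hs t ht)
  have hzc : ContinuousOn (fun t => φ (σ t)) (Icc a b) :=
    φ.continuousOn.comp (hσc.mono hsub) hs
  have hφcc : ∀ t ∈ Icc a b, Tendsto (fun p : α × ℝ => φ (γ p.1 p.2)) (G ×ˢ 𝓝[Icc a b] t)
      (𝓝 (φ (σ t))) := fun t ht => (φ.continuousAt (hs t ht)).tendsto.comp (hccab t ht)
  have hDc : ContinuousOn (fun t => S.drift i (φ (σ t))) (Icc a b) :=
    (S.continuousOn_drift i).comp hzc hzt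
  have hLc : ContinuousOn (fun t => S.ctrl i (φ (σ t))) (Icc a b) :=
    (S.continuousOn_ctrl i).comp hzc hzt
  have hDu : TendstoUniformlyOn (fun x t => S.drift i (φ (γ x t)))
      (fun t => S.drift i (φ (σ t))) G (Icc a b) :=
    tendstoUniformlyOn_of_forall_tendsto isCompact_Icc hDc fun t ht =>
      (S.contDiffAt_drift i _ (hzt t ht)).continuousAt.tendsto.comp (hφcc t ht)
  have hLu : TendstoUniformlyOn (fun x t => S.ctrl i (φ (γ x t)))
      (fun t => S.ctrl i (φ (σ t))) G (Icc a b) :=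
    tendstoUniformlyOn_of_forall_tendsto isCompact_Icc hLc fun t ht =>
      (S.contDiffAt_ctrl i _ (hzt t ht)).continuousAt.tendsto.comp (hφcc t ht)
  have hDi : ∀ t ∈ Icc a b,
      IntervalIntegrable (fun t => S.drift i (φ (σ t))) volume a t := fun t ht =>
    (hDc.mono (Icc_subset_Icc_right ht.2)).intervalIntegrable_of_Icc ht.1
  have hLi : ∀ {v : ℝ → EuclideanSpace ℝ (Fin m)}, IsControl Ω T v → ∀ t ∈ Icc a b,
      IntervalIntegrable (fun t => S.ctrl i (φ (σ t)) (v t)) volume a t := fun hv t ht =>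
    hv.intervalIntegrable_clm hΩ.isBounded ha ht.1 (ht.2.trans hb)
      (hLc.mono (Icc_subset_Icc_right ht.2))
  have hbI : b ∈ Icc a b := ⟨hab, le_rfl⟩
  have haI : a ∈ Icc a b := ⟨le_rfl, hab⟩
  refine ⟨(hDi b hbI).add (hLi hw b hbI), fun t ht => ?_⟩
  obtain ⟨R, hR⟩ := hΩ.isBounded.exists_norm_le
  have hφt : ∀ t ∈ Icc a b, Tendsto (fun x => φ (γ x t)) G (𝓝 (φ (σ t))) := fun t ht =>
    (φ.continuousAt (hs t ht)).tendsto.comp (hγσ t (hsub ht))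
  have hint : ∀ᶠ x in G, HasACDeriv (fun t => φ (γ x t))
      (fun t => S.rhs i (φ (γ x t)) (u x t)) a b := by
    filter_upwards [hsrc] with x hx using (hγ x).2 i a b ha hab hb hx
  -- Freezing the coefficients along `σ` costs an error that vanishes, since they converge uniformly
  -- and the controls are bounded. What remains is affine in the control with fixed continuous
  -- coefficients, so weak convergence applies.
  have herr : Tendsto (fun x => ∫ s in a..t, (S.rhs i (φ (γ x s)) (u x s) -
      S.rhs i (φ (σ s)) (u x s))) G (𝓝 0) := by
    rw [Metric.tendsto_nhds]
    intro ε hε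
    -- The `+ 1` keeps the denominator positive when `t = a` and makes the final inequality strict.
    set η := ε / ((1 + |R|) * (t - a) + 1) with hη
    have hta : 0 ≤ t - a := sub_nonneg.2 ht.1
    have hden : 0 < (1 + |R|) * (t - a) + 1 := by positivity
    have hη0 : 0 < η := div_pos hε hden
    filter_upwards [Metric.tendstoUniformlyOn_iff.1 hDu η hη0,
      Metric.tendstoUniformlyOn_iff.1 hLu η hη0] with x hx1 hx2
    rw [dist_zero_right]
    have hbound : ∀ᵐ s : ℝ, s ∈ uIoc a t → ‖S.rhs i (φ (γ x s)) (u x s) -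
        S.rhs i (φ (σ s)) (u x s)‖ ≤ η * (1 + |R|) := by
      have := (hu x).ae_mem_Icc ha (ht.2.trans hb)
      rw [ae_restrict_iff' measurableSet_Icc] at this
      filter_upwards [this] with s hs1 hs2
      rw [uIoc_of_le ht.1] at hs2
      have hs3 : s ∈ Icc a b := ⟨hs2.1.le, hs2.2.trans ht.2⟩
      have h1 := hx1 s hs3
      have h2 := hx2 s hs3
      rw [dist_comm, dist_eq_norm] at h1 h2
      have h3 : ‖u x s‖ ≤ |R| := (hR _ (hs1 (Ioc_subset_Icc_self hs2))).trans (le_abs_self R)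
      calc ‖S.rhs i (φ (γ x s)) (u x s) - S.rhs i (φ (σ s)) (u x s)‖
          = ‖(S.drift i (φ (γ x s)) - S.drift i (φ (σ s))) +
              (S.ctrl i (φ (γ x s)) - S.ctrl i (φ (σ s))) (u x s)‖ := by
            rw [rhs, rhs, _root_.sub_apply]; congr 1; abel
        _ ≤ η + η * |R| := (norm_add_le _ _).trans (add_le_add h1.le
            (((_ : _ →L[ℝ] _).le_opNorm _).trans (mul_le_mul h2.le h3 (norm_nonneg _) hη0.le)))
        _ = η * (1 + |R|) := by ring
    have h4 := intervalIntegral.norm_integral_le_of_norm_le_const_ae hbound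
    rw [abs_of_nonneg hta] at h4
    refine h4.trans_lt ?_
    have h5 : η * ((1 + |R|) * (t - a) + 1) = ε := div_mul_cancel₀ _ hden.ne'
    nlinarith
  have hlim : Tendsto (fun x => φ (γ x a) + ((∫ s in a..t, (S.rhs i (φ (γ x s)) (u x s) -
      S.rhs i (φ (σ s)) (u x s))) + ((∫ s in a..t, S.drift i (φ (σ s))) +
        ∫ s in a..t, S.ctrl i (φ (σ s)) (u x s)))) G
      (𝓝 (φ (σ a) + (0 + ((∫ s in a..t, S.drift i (φ (σ s))) +
        ∫ s in a..t, S.ctrl i (φ (σ s)) (w s))))) :=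
    (hφt a haI).add (herr.add (tendsto_const_nhds.add
      (huw a t ha ht.1 (ht.2.trans hb) _ (hLc.mono (Icc_subset_Icc_right ht.2)))))
  have heq : ∀ᶠ x in G, φ (γ x a) + ((∫ s in a..t, (S.rhs i (φ (γ x s)) (u x s) -
      S.rhs i (φ (σ s)) (u x s))) + ((∫ s in a..t, S.drift i (φ (σ s))) +
        ∫ s in a..t, S.ctrl i (φ (σ s)) (u x s))) = φ (γ x t) := by
    filter_upwards [hint] with x hx
    have h1 := (hDi t ht).add (hLi (hu x) t ht)
    have h2 : IntervalIntegrable (fun s => S.rhs i (φ (σ s)) (u x s)) volume a t := h1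
    have h3 := hx.2 t ht
    beta_reduce at h3
    rw [← intervalIntegral.integral_add (hDi t ht) (hLi (hu x) t ht),
      intervalIntegral.integral_sub (hx.mono le_rfl ht.1 ht.2).1 h2, h3]
    simp only [rhs]
    abel
  have := tendsto_nhds_unique (hlim.congr' heq) (hφt t ht)
  beta_reduce
  rw [← this, zero_add, ← intervalIntegral.integral_add (hDi t ht) (hLi hw t ht)]
  rfl

/-- The end points at time `T` of the trajectories in `K` that start at `x₀`. -/
def reachable (Ω : Set (EuclideanSpace ℝ (Fin m))) (K : Set X) (x₀ : X) (T : ℝ) : Set X :=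
  {x | ∃ u γ, IsControl Ω T u ∧ S.SolvesOn 0 T u γ ∧ γ 0 = x₀ ∧ (∀ t ∈ Icc 0 T, γ t ∈ K) ∧
    γ T = x}

/-- Indexing by pairs (control, trajectory) lets one ultrafilter choose the weak limit of the
controls and, at every time, the limit in `K` of the trajectories. -/
theorem isCompact_reachable [T2Space X] [FiniteDimensional ℝ V] (hΩ : IsCompact Ω)
    (hΩc : Convex ℝ Ω) {K : Set X} (hK : IsCompact K) (x₀ : X) {T : ℝ} (hT : 0 ≤ T) :
    IsCompact (S.reachable Ω K x₀ T) := by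
  have : Nonempty X := ⟨x₀⟩
  let α := {p : (ℝ → EuclideanSpace ℝ (Fin m)) × (ℝ → X) // IsControl Ω T p.1 ∧
    S.SolvesOn 0 T p.1 p.2 ∧ p.2 0 = x₀ ∧ ∀ t ∈ Icc 0 T, p.2 t ∈ K}
  have hrange : S.reachable Ω K x₀ T = range (fun p : α => p.1.2 T) := by
    ext x
    constructor
    · rintro ⟨u, γ, h1, h2, h3, h4, rfl⟩
      exact ⟨⟨(u, γ), h1, h2, h3, h4⟩, rfl⟩
    · rintro ⟨⟨⟨u, γ⟩, h1, h2, h3, h4⟩, rfl⟩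
      exact ⟨u, γ, h1, h2, h3, h4, rfl⟩
  rw [hrange]
  refine isCompact_range_of_ultrafilter fun G => ?_
  obtain ⟨w, hw, huw⟩ := exists_isControl_weak_limit G hΩ hΩc hT (u := fun p : α => p.1.1)
    (fun p => p.2.1) V
  have hex : ∀ t ∈ Icc 0 T, ∃ y ∈ K, Tendsto (fun p : α => p.1.2 t) G (𝓝 y) := fun t ht =>
    hK.ultrafilter_le_nhds (G.map fun p : α => p.1.2 t)
      (le_principal_iff.2 (mem_map.2 (univ_mem' fun p => p.2.2.2.2 t ht)))
  choose! σ hσK hσ using hex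
  have hsol := S.solvesOn_of_tendsto hΩ (G := (G : Filter α)) (fun p : α => p.2.1)
    (fun p : α => p.2.2.1) hw huw hσ
  have h0 : σ 0 = x₀ := by
    refine tendsto_nhds_unique (hσ 0 ⟨le_rfl, hT⟩) (tendsto_const_nhds.congr fun p => ?_)
    exact p.2.2.2.1.symm
  exact ⟨σ T, ⟨⟨(w, σ), hw, hsol, h0, hσK⟩, rfl⟩, hσ T ⟨hT, le_rfl⟩⟩

end Controlled

end ControlSystem

/-- The fixed point of the Picard map takes values in the ball of radius `a`. This is recorded
because the solution must not leave the chart. -/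
theorem _root_.IsPicardLindelof.exists_eq_forall_mem_Icc_hasDerivWithinAt_mem_closedBall
    {V : Type*} [NormedAddCommGroup V] [NormedSpace ℝ V] [CompleteSpace V] {f : ℝ → V → V}
    {tmin tmax : ℝ} {t₀ : Icc tmin tmax} {x₀ x : V} {a r L K : NNReal}
    (hf : IsPicardLindelof f t₀ x₀ a r L K) (hx : x ∈ Metric.closedBall x₀ r) :
    ∃ β : ℝ → V, β t₀ = x ∧ ∀ t ∈ Icc tmin tmax, β t ∈ Metric.closedBall x₀ a ∧
      HasDerivWithinAt β (f t (β t)) (Icc tmin tmax) t := by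
  obtain ⟨α, hα⟩ := ODE.FunSpace.exists_isFixedPt_next hf hx
  have heq : ∀ t ∈ Icc tmin tmax, α.compProj t = ODE.picard f t₀ x α.compProj t := by
    intro t ht
    conv_lhs => rw [← hα]
    rw [ODE.FunSpace.compProj_apply, ODE.FunSpace.next_apply, projIcc_of_mem _ ht]
  refine ⟨α.compProj, ?_, fun t ht => ⟨?_, ?_⟩⟩
  · rw [heq _ t₀.2]
    simp
  · exact α.compProj_mem_closedBall hf.mul_max_le
  · exact (ODE.hasDerivWithinAt_picard_Icc t₀.2 hf.continuousOn_uncurry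
      α.continuous_compProj.continuousOn
      (fun _ _ => α.compProj_mem_closedBall hf.mul_max_le) x ht).congr_of_mem heq ht

namespace ControlSystem

/-! ### Existence for a constant control, with a time uniform over compact sets. -/

section Exist

variable {ι X V U : Type*} [TopologicalSpace X] [NormedAddCommGroup V]
    [NormedSpace ℝ V] [NormedAddCommGroup U] [NormedSpace ℝ U] (S : ControlSystem ι X V U)

/-- A classical solution in one chart is a solution in every chart. -/
theorem solvesOn_of_hasDerivWithinAt [CompleteSpace V] {i : ι} {c d : ℝ} {u₀ : U} {β : ℝ → V}
    (hβ : ∀ t ∈ Icc c d, β t ∈ (S.chart i).target)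
    (hd : ∀ t ∈ Icc c d, HasDerivWithinAt β (S.rhs i (β t) u₀) (Icc c d) t) :
    S.SolvesOn c d (fun _ => u₀) (fun t => (S.chart i).symm (β t)) := by
  have hc : ContinuousOn (fun t => (S.chart i).symm (β t)) (Icc c d) :=
    (S.chart i).continuousOn_symm.comp (fun t ht => (hd t ht).continuousWithinAt) hβ
  refine ⟨hc, fun j a b ha hab hb hs => ?_⟩
  have hsub : Icc a b ⊆ Icc c d := Icc_subset_Icc ha hb
  refine hasACDeriv_of_hasDerivWithinAt hab (fun t ht => ?_) ?_
  · obtain ⟨D, hD, hDu⟩ := S.compat i j (β t) (hβ t (hsub ht)) (hs t ht)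
    have := hD.comp_hasDerivWithinAt t ((hd t (hsub ht)).mono hsub)
    rw [rhs, hDu] at this
    exact this
  · have h1 : ContinuousOn (fun t => (S.chart j ((S.chart i).symm (β t)), u₀)) (Icc a b) :=
      ((S.chart j).continuousOn.comp (hc.mono hsub) hs).prodMk continuousOn_const
    exact (S.continuousOn_rhs j).comp h1 fun t ht =>
      ⟨(S.chart j).map_source (hs t ht), mem_univ _⟩

/-- With a constant control the equation is autonomous and `C¹`, so one existence time serves all
nearby initial points and all initial times `c`. -/
theorem exists_nhds_forall_exists_solvesOn [CompleteSpace V] (x : X) (u₀ : U) :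
    ∃ A ∈ 𝓝 x, ∃ ε > 0, ∀ y ∈ A, ∀ c : ℝ, ∃ σ : ℝ → X, σ c = y ∧
      S.SolvesOn c (c + ε) (fun _ => u₀) σ := by
  obtain ⟨i, hi⟩ := S.exists_mem_source x
  set φ := S.chart i with hφ
  have hz : φ x ∈ φ.target := φ.map_source hi
  have hC1 : ContDiffAt ℝ 1 (fun z => S.rhs i z u₀) (φ x) :=
    (S.contDiffAt_drift i _ hz).add ((S.contDiffAt_ctrl i _ hz).clm_apply contDiffAt_const)
  obtain ⟨ε, hε, a, r, L, K, hr, hPL⟩ := IsPicardLindelof.of_contDiffAt_one hC1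
  obtain ⟨ρ, hρ, hsub⟩ := Metric.nhds_basis_closedBall.mem_iff.1 (φ.open_target.mem_nhds hz)
  have ha0 : 0 < a := by
    have h1 := (hPL 0).mul_max_le
    have h2 : (0 : ℝ) ≤ a - r := le_trans (by simp; positivity) h1
    have h3 : (0 : ℝ) < r := hr
    exact_mod_cast (by linarith : (0 : ℝ) < a)
  set a' : NNReal := min a (Real.toNNReal ρ) with ha'
  have ha'0 : 0 < a' := lt_min ha0 (Real.toNNReal_pos.2 hρ)
  -- The radius `a' ≤ ρ` keeps solutions in the chart target. Half of it is left for the choice of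
  -- the initial point.
  obtain ⟨ε', hε', hPL0⟩ := (hPL 0).exists_shrink_radius hε (a' := a') (r' := a' / 2)
    (min_le_left _ _) (NNReal.half_lt_self ha'0.ne')
  have ha'ρ : (a' : ℝ) ≤ ρ := by
    have : a' ≤ Real.toNNReal ρ := min_le_right _ _
    exact (NNReal.coe_le_coe.2 this).trans (Real.coe_toNNReal ρ hρ.le).le
  have hr' : (0 : ℝ) < (a' / 2 : NNReal) := by exact_mod_cast half_pos ha'0
  refine ⟨φ.source ∩ φ ⁻¹' Metric.ball (φ x) (a' / 2 : NNReal),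
    (φ.isOpen_inter_preimage Metric.isOpen_ball).mem_nhds ⟨hi, Metric.mem_ball_self hr'⟩,
    ε', hε', fun y hy c => ?_⟩
  have hPLc : IsPicardLindelof (fun _ z => S.rhs i z u₀) (tmin := c - ε') (tmax := c + ε')
      ⟨c, by simp [hε'.le]⟩ (φ x) a' (a' / 2) L K :=
    IsPicardLindelof.of_time_independent (fun z hz => hPL0.norm_le 0 (by simp [hε'.le]) z hz)
      (hPL0.lipschitzOnWith 0 (by simp [hε'.le])) (by simpa using hPL0.mul_max_le)
  obtain ⟨β, hβ0, hβ⟩ := hPLc.exists_eq_forall_mem_Icc_hasDerivWithinAt_mem_closedBall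
    (Metric.ball_subset_closedBall hy.2)
  have hIcc : Icc c (c + ε') ⊆ Icc (c - ε') (c + ε') := Icc_subset_Icc_left (by linarith)
  refine ⟨fun t => φ.symm (β t), ?_, S.solvesOn_of_hasDerivWithinAt (fun t ht =>
    hsub (Metric.closedBall_subset_closedBall ha'ρ (hβ t (hIcc ht)).1))
    fun t ht => (hβ t (hIcc ht)).2.mono hIcc⟩
  have : β c = φ y := hβ0
  simp only [this, φ.left_inv hy.1]

theorem exists_forall_exists_solvesOn [CompleteSpace V] {K : Set X} (hK : IsCompact K) (u₀ : U) :
    ∃ ε > 0, ∀ y ∈ K, ∀ c d : ℝ, d ≤ c + ε → ∃ σ : ℝ → X, σ c = y ∧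
      S.SolvesOn c d (fun _ => u₀) σ := by
  refine hK.induction_on (p := fun B => ∃ ε > 0, ∀ y ∈ B, ∀ c d : ℝ, d ≤ c + ε →
    ∃ σ : ℝ → X, σ c = y ∧ S.SolvesOn c d (fun _ => u₀) σ) ⟨1, one_pos, by simp⟩ ?_ ?_ ?_
  · rintro A B hAB ⟨ε, hε, h⟩
    exact ⟨ε, hε, fun y hy => h y (hAB hy)⟩
  · rintro A B ⟨ε₁, hε₁, h₁⟩ ⟨ε₂, hε₂, h₂⟩
    refine ⟨min ε₁ ε₂, lt_min hε₁ hε₂, fun y hy c d hd => ?_⟩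
    rcases hy with hy | hy
    · exact h₁ y hy c d (hd.trans (by gcongr; exact min_le_left _ _))
    · exact h₂ y hy c d (hd.trans (by gcongr; exact min_le_right _ _))
  · intro x _
    obtain ⟨A, hA, ε, hε, h⟩ := S.exists_nhds_forall_exists_solvesOn x u₀
    refine ⟨A, mem_nhdsWithin_of_mem_nhds hA, ε, hε, fun y hy c d hd => ?_⟩
    obtain ⟨σ, hσ, hs⟩ := h y hy c
    exact ⟨σ, hσ, hs.mono le_rfl hd⟩

end Exist

/-! ### Equicontinuity and Hausdorff continuity of reachable sets. -/

section Controlled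

variable {ι X V : Type*} [NormedAddCommGroup V] [NormedSpace ℝ V] {m : ℕ}
  {Ω : Set (EuclideanSpace ℝ (Fin m))}

theorem SolvesOn.exists_extend [TopologicalSpace X]
    {S : ControlSystem ι X V (EuclideanSpace ℝ (Fin m))}
    (hΩ : Bornology.IsBounded Ω) {T T' : ℝ} (hT : 0 ≤ T) (hTT' : T ≤ T')
    {u : ℝ → EuclideanSpace ℝ (Fin m)} {γ σ : ℝ → X} (hu : IsControl Ω T u)
    (hγ : S.SolvesOn 0 T u γ) {u₀ : EuclideanSpace ℝ (Fin m)} (hu₀ : u₀ ∈ Ω)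
    (hσ : S.SolvesOn T T' (fun _ => u₀) σ) (hσT : σ T = γ T) :
    ∃ u' γ', IsControl Ω T' u' ∧ S.SolvesOn 0 T' u' γ' ∧ ∀ t ≤ T, γ' t = γ t := by
  refine ⟨_, fun t => if t ≤ T then γ t else σ t, hu.extend hΩ hu₀ T',
    SolvesOn.trans (hγ.congr (fun t ht => if_pos ht.2) fun t ht => if_pos ht.2)
      (hσ.congr (fun t ht => ?_) fun t ht => if_neg (not_le.2 ht.1)) hT hTT',
    fun t ht => if_pos ht⟩
  split_ifs with h
  · rw [le_antisymm h ht.1, hσT]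
  · rfl

/-- Trajectories in a compact set are uniformly equicontinuous. -/
theorem exists_forall_edist_le [EMetricSpace X] [FiniteDimensional ℝ V]
    (S : ControlSystem ι X V (EuclideanSpace ℝ (Fin m))) (hΩ : IsCompact Ω) {K : Set X}
    (hK : IsCompact K) {ε : ℝ≥0∞} (hε : 0 < ε) :
    ∃ δ > 0, ∀ T u γ, IsControl Ω T u → S.SolvesOn 0 T u γ →
      ∀ a ∈ Icc 0 T, γ a ∈ K → ∀ t ∈ Icc 0 T, |t - a| ≤ δ → edist (γ t) (γ a) ≤ ε := by
  have : ProperSpace V := FiniteDimensional.proper ℝ V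
  refine hK.induction_on (p := fun B => ∃ δ > 0, ∀ T u γ, IsControl Ω T u → S.SolvesOn 0 T u γ →
      ∀ a ∈ Icc 0 T, γ a ∈ B → ∀ t ∈ Icc 0 T, |t - a| ≤ δ → edist (γ t) (γ a) ≤ ε)
    ⟨1, one_pos, by simp⟩ ?_ ?_ ?_
  · rintro A B hAB ⟨δ, hδ, h⟩
    exact ⟨δ, hδ, fun T u γ hu hγ a ha haA => h T u γ hu hγ a ha (hAB haA)⟩
  · rintro A B ⟨δ₁, hδ₁, h₁⟩ ⟨δ₂, hδ₂, h₂⟩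
    refine ⟨min δ₁ δ₂, lt_min hδ₁ hδ₂, fun T u γ hu hγ a ha haA t ht htδ => ?_⟩
    rcases haA with haA | haA
    · exact h₁ T u γ hu hγ a ha haA t ht (htδ.trans (min_le_left _ _))
    · exact h₂ T u γ hu hγ a ha haA t ht (htδ.trans (min_le_right _ _))
  · intro x _
    have hε2 : 0 < ε / 2 := ENNReal.half_pos hε.ne'
    have hN : {y | edist y x < ε / 2} ∈ 𝓝 x := Metric.eball_mem_nhds x hε2
    obtain ⟨A, hA, δ, hδ, h⟩ := S.exists_nhds_forall_mem hΩ hN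
    refine ⟨A ∩ {y | edist y x < ε / 2}, mem_nhdsWithin_of_mem_nhds (inter_mem hA hN), δ, hδ,
      fun T u γ hu hγ a ha haA t ht htδ => ?_⟩
    have h1 : edist (γ t) x < ε / 2 := h T u γ hu hγ a ha haA.1 t ht htδ
    have h2 : edist (γ a) x < ε / 2 := haA.2
    calc edist (γ t) (γ a) ≤ edist (γ t) x + edist (γ a) x := edist_triangle_right _ _ _
      _ ≤ ε / 2 + ε / 2 := add_le_add h1.le h2.le
      _ = ε := ENNReal.add_halves ε

theorem hausdorffContinuousOn_reachable [τ : TopologicalSpace X] [FiniteDimensional ℝ V]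
    (S : ControlSystem ι X V (EuclideanSpace ℝ (Fin m))) (hΩ : IsCompact Ω) (hΩn : Ω.Nonempty)
    {K : Set X} (hK : IsCompact K) (x₀ : X) {T : ℝ}
    (hstay : ∀ r ∈ Icc 0 T, ∀ u γ, IsControl Ω r u → S.SolvesOn 0 r u γ → γ 0 = x₀ →
      ∀ t ∈ Icc 0 r, γ t ∈ K) :
    HausdorffContinuousOn (fun t => S.reachable Ω K x₀ t) (Icc 0 T) := by
  intro d hd
  subst hd
  have : CompleteSpace V := FiniteDimensional.complete ℝ V
  intro t ht
  rw [ENNReal.tendsto_nhds_zero]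
  intro ε hε
  obtain ⟨u₀, hu₀⟩ := hΩn
  obtain ⟨δ₁, hδ₁, h₁⟩ := S.exists_forall_edist_le hΩ hK hε
  obtain ⟨δ₂, hδ₂, h₂⟩ := S.exists_forall_exists_solvesOn hK u₀
  have key : ∀ s ∈ Icc 0 T, ∀ r ∈ Icc 0 T, s ≤ r → r - s ≤ min δ₁ δ₂ →
      Metric.hausdorffEDist (S.reachable Ω K x₀ s) (S.reachable Ω K x₀ r) ≤ ε := by
    intro s hs r hr hsr hδ
    have hs0 : (0 : ℝ) ∈ Icc 0 s := ⟨le_rfl, hs.1⟩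
    have habs : |r - s| ≤ δ₁ := by
      rw [abs_of_nonneg (sub_nonneg.2 hsr)]
      exact hδ.trans (min_le_left _ _)
    have hsI : s ∈ Icc 0 r := ⟨hs.1, hsr⟩
    have hrI : r ∈ Icc 0 r := ⟨hr.1, le_rfl⟩
    refine Metric.hausdorffEDist_le_of_mem_edist ?_ ?_
    · rintro _ ⟨u, γ, hu, hγ, hγ0, hγK, rfl⟩
      obtain ⟨σ, hσ, hσs⟩ := h₂ (γ s) (hγK s ⟨hs.1, le_rfl⟩) s r
        (by linarith [min_le_right δ₁ δ₂])
      obtain ⟨u', γ', hu', hγ', heq⟩ := SolvesOn.exists_extend hΩ.isBounded hs.1 hsr hu hγ hu₀ hσs hσ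
      have h0 : γ' 0 = x₀ := (heq 0 hs.1).trans hγ0
      -- The only use of `hstay`: nothing else prevents the prolonged part from leaving `K`.
      have hK' := hstay r hr u' γ' hu' hγ' h0
      refine ⟨γ' r, ⟨u', γ', hu', hγ', h0, hK', rfl⟩, ?_⟩
      rw [← heq s le_rfl, edist_comm]
      exact h₁ r u' γ' hu' hγ' s hsI (hK' s hsI) r hrI habs
    · rintro _ ⟨u, γ, hu, hγ, hγ0, hγK, rfl⟩
      exact ⟨γ s, ⟨u, γ, hu.mono hsr, hγ.mono le_rfl hsr, hγ0,
        fun q hq => hγK q ⟨hq.1, hq.2.trans hsr⟩, rfl⟩, h₁ r u γ hu hγ s hsI (hγK s hsI) r hrI habs⟩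
  filter_upwards [inter_mem_nhdsWithin (Icc 0 T)
    (Metric.closedBall_mem_nhds t (lt_min hδ₁ hδ₂))] with s hs
  have hst : |s - t| ≤ min δ₁ δ₂ := by simpa [Real.dist_eq] using hs.2
  rcases le_total s t with h | h
  · exact key s hs.1 t ht h (by rw [abs_sub_comm] at hst; exact (le_abs_self _).trans hst)
  · rw [Metric.hausdorffEDist_comm]
    exact key t ht s hs.1 h ((le_abs_self _).trans hst)

end Controlled

end ControlSystem

/-! ### Christoffel symbols under a change of coordinates. -/

section Calculus

variable {E : Type*} [NormedAddCommGroup E] [NormedSpace ℝ E]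

theorem isInvertible_of_pos [FiniteDimensional ℝ E] (B : E →L[ℝ] E →L[ℝ] ℝ)
    (hB : ∀ v, v ≠ 0 → 0 < B v v) : B.IsInvertible := by
  have : CompleteSpace E := FiniteDimensional.complete ℝ E
  have hinj : Function.Injective (B : E →ₗ[ℝ] E →L[ℝ] ℝ) := by
    rw [injective_iff_map_eq_zero]
    intro v hv
    by_contra hne
    have h := hB v hne
    have h0 : B v = 0 := hv
    simp [h0] at h
  have hdim : Module.finrank ℝ E = Module.finrank ℝ (E →L[ℝ] ℝ) := by
    rw [← (LinearMap.toContinuousLinearMap (𝕜 := ℝ) (E := E) (F' := ℝ)).finrank_eq]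
    exact (Subspace.dual_finrank_eq (K := ℝ) (V := E)).symm
  exact ⟨(LinearEquiv.ofInjectiveOfFinrankEq (B : E →ₗ[ℝ] E →L[ℝ] ℝ) hinj
    hdim).toContinuousLinearEquiv, by ext v w; rfl⟩

/-- The Leibniz rule for the pullback of `k` by `θ`: one term differentiates `k`, the other two
differentiate the factors `fderiv ℝ θ`. -/
theorem fderiv_pullback_apply {h k : E → E →L[ℝ] E →L[ℝ] ℝ} {θ : E → E} {x : E}
    (hθ : ContDiffAt ℝ 2 θ x) (hh : DifferentiableAt ℝ h x) (hk : DifferentiableAt ℝ k (θ x))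
    (hhk : ∀ᶠ y in 𝓝 x, ∀ a b, h y a b = k (θ y) (fderiv ℝ θ y a) (fderiv ℝ θ y b)) (c a b : E) :
    fderiv ℝ h x c a b =
      fderiv ℝ k (θ x) (fderiv ℝ θ x c) (fderiv ℝ θ x a) (fderiv ℝ θ x b) +
      k (θ x) (fderiv ℝ (fderiv ℝ θ) x c a) (fderiv ℝ θ x b) +
      k (θ x) (fderiv ℝ θ x a) (fderiv ℝ (fderiv ℝ θ) x c b) := by
  have hθ1 : HasFDerivAt θ (fderiv ℝ θ x) x := (hθ.differentiableAt (by norm_num)).hasFDerivAt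
  have hθ2 : HasFDerivAt (fderiv ℝ θ) (fderiv ℝ (fderiv ℝ θ) x) x :=
    ((hθ.fderiv_right (m := 1) (by norm_num)).differentiableAt (by norm_num)).hasFDerivAt
  have hv : ∀ a, HasFDerivAt (fun y => fderiv ℝ θ y a) ((fderiv ℝ (fderiv ℝ θ) x).flip a) x := by
    intro a
    have := hθ2.clm_apply (hasFDerivAt_const a x)
    simpa using this
  have hL : HasFDerivAt (fun y => h y a b) (((fderiv ℝ h x).flip a).flip b) x := by
    have := (hh.hasFDerivAt.clm_apply (hasFDerivAt_const a x)).clm_apply (hasFDerivAt_const b x)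
    simpa using this
  have hR₀ : HasFDerivAt (fun y => k (θ y)) ((fderiv ℝ k (θ x)).comp (fderiv ℝ θ x)) x :=
    HasFDerivAt.comp (g := k) x hk.hasFDerivAt hθ1
  have hR := (hR₀.clm_apply (hv a)).clm_apply (hv b)
  have heq : (fun y => h y a b) =ᶠ[𝓝 x]
      fun y => k (θ y) (fderiv ℝ θ y a) (fderiv ℝ θ y b) := hhk.mono fun y hy => hy a b
  have := congrArg (fun D : E →L[ℝ] ℝ => D c) (hL.unique (hR.congr_of_eventuallyEq heq))
  simp at this
  rw [this]
  ring

/-- The transformation law of the Christoffel symbols, for bilinear forms `h` and `k` related by the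
change of coordinates `θ`. -/
theorem christoffel_transform {h k : E → E →L[ℝ] E →L[ℝ] ℝ} {θ : E → E} {x : E}
    (hθ : ContDiffAt ℝ 2 θ x) (hh : DifferentiableAt ℝ h x) (hk : DifferentiableAt ℝ k (θ x))
    (hhk : ∀ᶠ y in 𝓝 x, ∀ a b, h y a b = k (θ y) (fderiv ℝ θ y a) (fderiv ℝ θ y b))
    (hsymm : ∀ a b, k (θ x) a b = k (θ x) b a) (hpos : ∀ v, v ≠ 0 → 0 < k (θ x) v v)
    (hsurj : Function.Surjective (fderiv ℝ θ x)) {a b Γh Γk : E}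
    (hΓh : ∀ c, h x Γh c =
      1 / 2 * (fderiv ℝ h x a b c + fderiv ℝ h x b a c - fderiv ℝ h x c a b))
    (hΓk : ∀ c, k (θ x) Γk c =
      1 / 2 * (fderiv ℝ k (θ x) (fderiv ℝ θ x a) (fderiv ℝ θ x b) c +
        fderiv ℝ k (θ x) (fderiv ℝ θ x b) (fderiv ℝ θ x a) c -
        fderiv ℝ k (θ x) c (fderiv ℝ θ x a) (fderiv ℝ θ x b))) :
    fderiv ℝ θ x Γh = fderiv ℝ (fderiv ℝ θ) x a b + Γk := by
  -- Every `w` is the image of some `c`, so both symbols can be tested. Of the six second-derivative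
  -- terms four cancel by symmetry, and the two equal ones that remain absorb the factor `1 / 2`.
  have key : ∀ w, k (θ x) (fderiv ℝ θ x Γh - (fderiv ℝ (fderiv ℝ θ) x a b + Γk)) w = 0 := by
    intro w
    obtain ⟨c, rfl⟩ := hsurj w
    have h1 := hΓh c
    rw [hhk.self_of_nhds Γh c] at h1
    simp only [fderiv_pullback_apply hθ hh hk hhk] at h1
    have hs : ∀ a b, fderiv ℝ (fderiv ℝ θ) x a b = fderiv ℝ (fderiv ℝ θ) x b a :=
      fun a b => (hθ.isSymmSndFDerivAt (by simp)) a b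
    rw [map_sub, map_add, _root_.sub_apply, _root_.add_apply, h1, hΓk, hs b a, hs c a, hs c b,
      hsymm (fderiv ℝ θ x b) (fderiv ℝ (fderiv ℝ θ) x a c)]
    ring
  by_contra hne
  have := hpos _ (sub_ne_zero.2 hne)
  rw [key] at this
  exact lt_irrefl _ this

end Calculus

/-! ### Vectors, metric, Christoffel symbols and gradient in the charts of `M`. -/

section Manifold

variable {E : Type*} [NormedAddCommGroup E] [NormedSpace ℝ E]
  {M : Type*} [TopologicalSpace M] [ChartedSpace E M] [IsManifold 𝓘(ℝ, E) ∞ M]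

/-- The change of coordinates from the chart attached to `p` to the chart attached to `p'`. -/
def transition (E : Type*) [NormedAddCommGroup E] {M : Type*} [TopologicalSpace M]
    [ChartedSpace E M] (p p' : M) : E → E := chartAt E p' ∘ (chartAt E p).symm

theorem contDiffAt_transition {p p' : M} {x : E}
    (hx : x ∈ (chartAt E p).target) (hx' : (chartAt E p).symm x ∈ (chartAt E p').source) :
    ContDiffAt ℝ ∞ (transition E p p') x := by
  have := contDiffWithinAt_ext_coord_change (I := 𝓘(ℝ, E)) (n := ∞) p' p (y := x) (by
    simp [hx, hx'])
  simpa [transition, contDiffWithinAt_univ] using this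

theorem tangentCoord_transition {p p' : M} {x : E}
    (hx : x ∈ (chartAt E p).target) (hx' : (chartAt E p).symm x ∈ (chartAt E p').source)
    (v : TangentSpace 𝓘(ℝ, E) ((chartAt E p).symm x)) :
    tangentCoord p' ((chartAt E p).symm x) v =
      fderiv ℝ (transition E p p') x (tangentCoord p ((chartAt E p).symm x) v) := by
  set q := (chartAt E p).symm x with hq
  have hqp : q ∈ (chartAt E p).source := (chartAt E p).map_target hx
  have : IsManifold 𝓘(ℝ, E) 1 M := IsManifold.of_le (n := ∞) (by norm_num)
  have h1 : tangentCoordChange 𝓘(ℝ, E) p p' q = fderiv ℝ (transition E p p') x := by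
    rw [tangentCoordChange_def]
    simp [transition, hq, (chartAt E p).right_inv hx]
  rw [tangentCoord, tangentCoord,
    TangentBundle.continuousLinearMapAt_trivializationAt_eq_core hx',
    TangentBundle.continuousLinearMapAt_trivializationAt_eq_core hqp, ← h1]
  refine (tangentCoordChange_comp (I := 𝓘(ℝ, E)) (w := q) (x := p) (y := p') (z := q) ?_).symm
  simp [hqp, hx']

/-- The tangent vector at `q` with components `w` in the chart attached to `p`. -/
def tangentVec (p q : M) (w : E) : TangentSpace 𝓘(ℝ, E) q :=
  (trivializationAt E (fun q : M => TangentSpace 𝓘(ℝ, E) q) p).symmL ℝ q w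

theorem tangentCoord_tangentVec {p q : M} (hq : q ∈ (chartAt E p).source) (w : E) :
    tangentCoord p q (tangentVec p q w) = w :=
  (trivializationAt E (fun q : M => TangentSpace 𝓘(ℝ, E) q) p).continuousLinearMapAt_symmL hq w

theorem tangentVec_tangentCoord {p q : M} (hq : q ∈ (chartAt E p).source)
    (v : TangentSpace 𝓘(ℝ, E) q) : tangentVec p q (tangentCoord p q v) = v :=
  (trivializationAt E (fun q : M => TangentSpace 𝓘(ℝ, E) q) p).symmL_continuousLinearMapAt hq v

theorem metricInChart_apply (g : RiemMetric E M) (p : M) (x a b : E) :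
    metricInChart g p x a b = g.inner ((chartAt E p).symm x)
      (tangentVec p ((chartAt E p).symm x) a) (tangentVec p ((chartAt E p).symm x) b) := rfl

theorem surjective_fderiv_transition {p p' : M} {x : E}
    (hx : x ∈ (chartAt E p).target) (hx' : (chartAt E p).symm x ∈ (chartAt E p').source) :
    Function.Surjective (fderiv ℝ (transition E p p') x) := fun w =>
  ⟨tangentCoord p ((chartAt E p).symm x) (tangentVec p' ((chartAt E p).symm x) w), by
    rw [← tangentCoord_transition hx hx', tangentCoord_tangentVec hx']⟩

theorem tangentVec_transition {p p' : M} {x : E}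
    (hx : x ∈ (chartAt E p).target) (hx' : (chartAt E p).symm x ∈ (chartAt E p').source) (w : E) :
    tangentVec p' ((chartAt E p).symm x) (fderiv ℝ (transition E p p') x w) =
      tangentVec p ((chartAt E p).symm x) w := by
  have h := tangentCoord_transition hx hx' (tangentVec p ((chartAt E p).symm x) w)
  rw [tangentCoord_tangentVec ((chartAt E p).map_target hx)] at h
  rw [← h, tangentVec_tangentCoord hx']

theorem metricInChart_transition (g : RiemMetric E M) {p p' : M} {x : E}
    (hx : x ∈ (chartAt E p).target) (hx' : (chartAt E p).symm x ∈ (chartAt E p').source) (a b : E) :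
    metricInChart g p x a b = metricInChart g p' (transition E p p' x)
      (fderiv ℝ (transition E p p') x a) (fderiv ℝ (transition E p p') x b) := by
  have hq : (chartAt E p').symm (transition E p p' x) = (chartAt E p).symm x :=
    (chartAt E p').left_inv hx'
  -- The base points agree by a proposition only, and the types of the tangent vectors depend on
  -- them. Generalising the base point permits the substitution.
  have hcongr : ∀ q : M, q = (chartAt E p).symm x → ∀ a b : E,
      g.inner q (tangentVec p' q a) (tangentVec p' q b) = g.inner ((chartAt E p).symm x)
        (tangentVec p' ((chartAt E p).symm x) a) (tangentVec p' ((chartAt E p).symm x) b) := by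
    rintro _ rfl a b
    rfl
  rw [metricInChart_apply, metricInChart_apply, hcongr _ hq, tangentVec_transition hx hx',
    tangentVec_transition hx hx']

theorem metricInChart_symm (g : RiemMetric E M) (p : M) (x a b : E) :
    metricInChart g p x a b = metricInChart g p x b a := by
  rw [metricInChart_apply, metricInChart_apply, g.symm]

theorem metricInChart_pos (g : RiemMetric E M) {p : M} {x : E} (hx : x ∈ (chartAt E p).target)
    {v : E} (hv : v ≠ 0) : 0 < metricInChart g p x v v := by
  rw [metricInChart_apply]
  refine g.pos _ _ fun h0 => hv ?_
  have h1 := tangentCoord_tangentVec ((chartAt E p).map_target hx) v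
  rw [h0] at h1
  exact h1.symm.trans (map_zero _)

theorem contDiffOn_tangentCoord {X : ∀ q : M, TangentSpace 𝓘(ℝ, E) q} (hX : SmoothVectorField X)
    (p : M) : ContDiffOn ℝ ∞ (fun x => tangentCoord p ((chartAt E p).symm x)
      (X ((chartAt E p).symm x))) (chartAt E p).target := by
  have h1 := ((trivializationAt E (fun q : M => TangentSpace 𝓘(ℝ, E) q)
    p).contMDiffOn_section_baseSet_iff (IB := 𝓘(ℝ, E)) (n := ∞) (s := X)).1 hX.contMDiffOn
  have h2 : ContMDiffOn 𝓘(ℝ, E) 𝓘(ℝ, E) ∞ (chartAt E p).symm (chartAt E p).target :=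
    contMDiffOn_chart_symm
  have h3 := h1.comp h2 fun x hx => (chartAt E p).map_target hx
  rw [contMDiffOn_iff_contDiffOn] at h3
  refine h3.congr fun x hx => ?_
  exact Bundle.Trivialization.continuousLinearMapAt_apply_of_mem (R := ℝ)
    (trivializationAt E (fun q : M => TangentSpace 𝓘(ℝ, E) q) p) ((chartAt E p).map_target hx) _

/-- In finite dimension smoothness can be tested on fixed `a` and `b`. These define sections with
constant components, hence smooth ones, and the smooth metric is evaluated on them. -/
theorem contDiffOn_metricInChart [FiniteDimensional ℝ E] (g : RiemMetric E M) (p : M) :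
    ContDiffOn ℝ ∞ (metricInChart g p) (chartAt E p).target := by
  rw [contDiffOn_clm_apply]
  intro a
  rw [contDiffOn_clm_apply]
  intro b
  set e := trivializationAt E (fun q : M => TangentSpace 𝓘(ℝ, E) q) p with he
  have hsec : ∀ a : E, ContMDiffOn 𝓘(ℝ, E) (𝓘(ℝ, E).prod 𝓘(ℝ, E)) ∞
      (fun q => Bundle.TotalSpace.mk' E (E := fun q : M => TangentSpace 𝓘(ℝ, E) q) q
        (e.symmL ℝ q a)) e.baseSet := by
    intro a
    rw [e.contMDiffOn_section_baseSet_iff]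
    refine (contMDiffOn_const (c := a)).congr fun q hq => ?_
    rw [← e.continuousLinearMapAt_apply_of_mem (R := ℝ) hq, e.continuousLinearMapAt_symmL hq]
  have h1 : ContMDiffOn 𝓘(ℝ, E) 𝓘(ℝ, ℝ) ∞
      (fun q => g.inner q (e.symmL ℝ q a) (e.symmL ℝ q b)) e.baseSet := by
    intro q hq
    have : ContMDiffWithinAt 𝓘(ℝ, E) (𝓘(ℝ, E).prod 𝓘(ℝ, ℝ)) ∞
        (fun q => Bundle.TotalSpace.mk' ℝ (E := Bundle.Trivial M ℝ) q
          (g.inner q (e.symmL ℝ q a) (e.symmL ℝ q b))) e.baseSet q :=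
      ContMDiffWithinAt.clm_bundle_apply₂ (F₁ := E) (F₂ := E)
        (g.contMDiff.contMDiffAt.contMDiffWithinAt) (hsec a q hq) (hsec b q hq)
    rw [Bundle.contMDiffWithinAt_totalSpace] at this
    exact this.2
  have h2 : ContMDiffOn 𝓘(ℝ, E) 𝓘(ℝ, E) ∞ (chartAt E p).symm (chartAt E p).target :=
    contMDiffOn_chart_symm
  have h3 := h1.comp h2 fun x hx => (chartAt E p).map_target hx
  rw [contMDiffOn_iff_contDiffOn] at h3
  exact h3

theorem contDiffAt_metricInChart [FiniteDimensional ℝ E] (g : RiemMetric E M) {p : M} {x : E}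
    (hx : x ∈ (chartAt E p).target) : ContDiffAt ℝ ∞ (metricInChart g p) x :=
  (contDiffOn_metricInChart g p).contDiffAt ((chartAt E p).open_target.mem_nhds hx)

theorem contDiffAt_inverse_metricInChart [FiniteDimensional ℝ E] (g : RiemMetric E M) {p : M}
    {x : E} (hx : x ∈ (chartAt E p).target) :
    ContDiffAt ℝ ∞ (fun y => (metricInChart g p y).inverse) x := by
  have : CompleteSpace E := FiniteDimensional.complete ℝ E
  exact ((isInvertible_of_pos _ fun v hv =>
    metricInChart_pos g hx hv).contDiffAt_map_inverse).comp x (contDiffAt_metricInChart g hx)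

/-- The inhomogeneous second-derivative term is the one that the derivative of the transition map of
`TM` adds to `v'`, which makes `Dv/Dt` independent of the chart. -/
theorem christoffel_transition [FiniteDimensional ℝ E] (g : RiemMetric E M) {p p' : M} {x : E}
    (hx : x ∈ (chartAt E p).target) (hx' : (chartAt E p).symm x ∈ (chartAt E p').source) (a b : E) :
    fderiv ℝ (transition E p p') x (christoffel g p x a b) =
      fderiv ℝ (fderiv ℝ (transition E p p')) x a b +
      christoffel g p' (transition E p p' x) (fderiv ℝ (transition E p p') x a)
        (fderiv ℝ (transition E p p') x b) := by
  have hθx : transition E p p' x ∈ (chartAt E p').target := (chartAt E p').map_source hx'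
  have hev : ∀ᶠ y in 𝓝 x, y ∈ (chartAt E p).target ∧ (chartAt E p).symm y ∈ (chartAt E p').source :=
    Filter.Eventually.and ((chartAt E p).open_target.mem_nhds hx)
      (((chartAt E p).continuousAt_symm hx).eventually ((chartAt E p').open_source.mem_nhds hx'))
  refine christoffel_transform (h := metricInChart g p) (k := metricInChart g p')
    ((contDiffAt_transition hx hx').of_le (WithTop.coe_le_coe.2 (le_top : (2 : ℕ∞) ≤ ⊤)))
    ((contDiffAt_metricInChart g hx).differentiableAt (by simp))
    ((contDiffAt_metricInChart g hθx).differentiableAt (by simp))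
    (hev.mono fun y hy => metricInChart_transition g hy.1 hy.2) (metricInChart_symm g p' _)
    (fun v hv => metricInChart_pos g hθx hv) (surjective_fderiv_transition hx hx')
    (metricInChart_christoffel g p hx a b) (metricInChart_christoffel g p' hθx _ _)

/-- The gradient is defined pointwise; this coordinate formula shows that it is smooth in charts. -/
theorem tangentCoord_grad [FiniteDimensional ℝ E] (g : RiemMetric E M) {W : M → ℝ}
    (hW : ContMDiff 𝓘(ℝ, E) 𝓘(ℝ, ℝ) ∞ W) {p : M} {x : E} (hx : x ∈ (chartAt E p).target) :
    tangentCoord p ((chartAt E p).symm x) (grad g W ((chartAt E p).symm x)) =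
      (metricInChart g p x).inverse (fderiv ℝ (W ∘ (chartAt E p).symm) x) := by
  set q := (chartAt E p).symm x with hq
  have hqp : q ∈ (chartAt E p).source := (chartAt E p).map_target hx
  have : IsManifold 𝓘(ℝ, E) 1 M := IsManifold.of_le (n := ∞) (by norm_num)
  have hinv := isInvertible_of_pos _ fun v hv => metricInChart_pos g hx hv
  rw [eq_comm, hinv.inverse_apply_eq]
  ext c
  rw [metricInChart_apply, ← hq, tangentVec_tangentCoord hqp, inner_grad]
  have h1 : MDifferentiableAt 𝓘(ℝ, E) 𝓘(ℝ, ℝ) W ((chartAt E p).symm x) :=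
    hW.mdifferentiable (by simp) _
  have h2 : MDifferentiableAt 𝓘(ℝ, E) 𝓘(ℝ, E) (chartAt E p).symm x :=
    ((contMDiffOn_chart_symm (I := 𝓘(ℝ, E)) (n := ∞) (x := p)).contMDiffAt
      ((chartAt E p).open_target.mem_nhds hx)).mdifferentiableAt (by simp)
  have h3 : mfderiv 𝓘(ℝ, E) 𝓘(ℝ, ℝ) (W ∘ (chartAt E p).symm) x =
      (mfderiv 𝓘(ℝ, E) 𝓘(ℝ, ℝ) W ((chartAt E p).symm x)).comp
        (mfderiv 𝓘(ℝ, E) 𝓘(ℝ, E) (chartAt E p).symm x) := mfderiv_comp x h1 h2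
  rw [mfderiv_eq_fderiv] at h3
  have h4 := congrArg (fun D : E →L[ℝ] ℝ => D c) h3
  refine h4.trans ?_
  have hxq : extChartAt 𝓘(ℝ, E) p q = x := by simp [hq, (chartAt E p).right_inv hx]
  have h5 : tangentVec p q c = mfderiv 𝓘(ℝ, E) 𝓘(ℝ, E) (chartAt E p).symm x c := by
    have h6 := TangentBundle.symmL_trivializationAt (I := 𝓘(ℝ, E)) (x₀ := p) hqp
    rw [hxq] at h6
    have h7 := congrArg (fun D : E →L[ℝ] E => D c) h6
    refine h7.trans ?_
    simp [mfderivWithin_univ]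
    rfl
  rw [h5]
  rfl

end Manifold

/-! ### The controlled dynamics as a control system on `TM`. -/

section TangentBundle

variable {E : Type*} [NormedAddCommGroup E] [NormedSpace ℝ E]
  {M : Type*} [TopologicalSpace M] [ChartedSpace E M] [IsManifold 𝓘(ℝ, E) ∞ M]

/-- The chart of `TM` induced by the chart of `M` attached to `p`. -/
def tangentChart (p : M) : OpenPartialHomeomorph (TangentBundle 𝓘(ℝ, E) M) (E × E) :=
  (trivializationAt E (fun q : M => TangentSpace 𝓘(ℝ, E) q) p).toOpenPartialHomeomorph.trans
    ((chartAt E p).prod (OpenPartialHomeomorph.refl E))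

theorem mem_tangentChart_source {p : M} {y : TangentBundle 𝓘(ℝ, E) M} :
    y ∈ (tangentChart p).source ↔ y.proj ∈ (chartAt E p).source := by
  simp only [tangentChart, mfld_simps]

theorem tangentChart_apply {p : M} {y : TangentBundle 𝓘(ℝ, E) M}
    (hy : y.proj ∈ (chartAt E p).source) :
    tangentChart p y = (chartAt E p y.proj, tangentCoord p y.proj y.snd) :=
  Prod.ext rfl (Bundle.Trivialization.continuousLinearMapAt_apply_of_mem (R := ℝ)
    (trivializationAt E (fun q : M => TangentSpace 𝓘(ℝ, E) q) p) hy y.snd).symm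

theorem mem_tangentChart_target {p : M} {z : E × E} :
    z ∈ (tangentChart p : OpenPartialHomeomorph (TangentBundle 𝓘(ℝ, E) M) (E × E)).target ↔
      z.1 ∈ (chartAt E p).target := by
  simp only [tangentChart, mfld_simps]
  exact ⟨fun h => h.1, fun h => ⟨h, (chartAt E p).map_target h⟩⟩

theorem tangentChart_symm_apply {p : M} {z : E × E} (hz : z.1 ∈ (chartAt E p).target) :
    (tangentChart p).symm z = (⟨(chartAt E p).symm z.1, tangentVec p ((chartAt E p).symm z.1) z.2⟩ :
      TangentBundle 𝓘(ℝ, E) M) := by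
  have hq : (chartAt E p).symm z.1 ∈ (chartAt E p).source := (chartAt E p).map_target hz
  refine (tangentChart p).injOn ((tangentChart p).map_target (mem_tangentChart_target.2 hz))
    (mem_tangentChart_source.2 hq) ?_
  rw [(tangentChart p).right_inv (mem_tangentChart_target.2 hz), tangentChart_apply hq,
    tangentCoord_tangentVec hq, (chartAt E p).right_inv hz]

/-- Two vectors at the same point lie in a common chart. Otherwise their base points are separated
in `M`. -/
theorem t2Space_tangentBundle [T2Space M] :
    T2Space (TangentBundle 𝓘(ℝ, E) M) := by
  refine ⟨fun y z hyz => ?_⟩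
  by_cases h : y.proj = z.proj
  · have hy : y ∈ (tangentChart y.proj).source :=
      mem_tangentChart_source.2 (mem_chart_source E y.proj)
    have hz : z ∈ (tangentChart y.proj).source :=
      mem_tangentChart_source.2 (h ▸ mem_chart_source E y.proj)
    obtain ⟨A, B, hA, hB, hyA, hzB, hAB⟩ :=
      t2_separation ((tangentChart y.proj).injOn.ne hy hz hyz)
    exact ⟨_, _, (tangentChart y.proj).isOpen_inter_preimage hA,
      (tangentChart y.proj).isOpen_inter_preimage hB, ⟨hy, hyA⟩, ⟨hz, hzB⟩,
      (hAB.preimage _).mono inter_subset_right inter_subset_right⟩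
  · exact separated_by_continuous (FiberBundle.continuous_proj E
      (fun q : M => TangentSpace 𝓘(ℝ, E) q)) h

theorem tangentChart_transition {p p' : M} {z : E × E} (hz : z.1 ∈ (chartAt E p).target)
    (hz' : (chartAt E p).symm z.1 ∈ (chartAt E p').source) :
    tangentChart p' ((tangentChart p).symm z : TangentBundle 𝓘(ℝ, E) M) =
      (transition E p p' z.1, fderiv ℝ (transition E p p') z.1 z.2) := by
  rw [tangentChart_symm_apply hz, tangentChart_apply hz', tangentCoord_transition hz hz',
    tangentCoord_tangentVec ((chartAt E p).map_target hz)]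
  rfl

theorem hasFDerivAt_tangentChart_transition {p p' : M} {z : E × E}
    (hz : z.1 ∈ (chartAt E p).target) (hz' : (chartAt E p).symm z.1 ∈ (chartAt E p').source) :
    ∃ D : E × E →L[ℝ] E × E,
      HasFDerivAt ((tangentChart p' : TangentBundle 𝓘(ℝ, E) M → E × E) ∘ (tangentChart p).symm) D z ∧
      ∀ w, D w = (fderiv ℝ (transition E p p') z.1 w.1,
        fderiv ℝ (fderiv ℝ (transition E p p')) z.1 w.1 z.2 +
          fderiv ℝ (transition E p p') z.1 w.2) := by
  set θ := transition E p p' with hθ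
  have h2 : ContDiffAt ℝ 2 θ z.1 :=
    (contDiffAt_transition hz hz').of_le (WithTop.coe_le_coe.2 (le_top : (2 : ℕ∞) ≤ ⊤))
  have hθ1 : HasFDerivAt θ (fderiv ℝ θ z.1) z.1 :=
    (h2.differentiableAt (by norm_num)).hasFDerivAt
  have hθ2 : HasFDerivAt (fderiv ℝ θ) (fderiv ℝ (fderiv ℝ θ) z.1) z.1 :=
    ((h2.fderiv_right (m := 1) (by norm_num)).differentiableAt (by norm_num)).hasFDerivAt
  have h3 : HasFDerivAt (fun y : E × E => θ y.1) _ z := hθ1.comp z hasFDerivAt_fst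
  have h4 : HasFDerivAt (fun y : E × E => fderiv ℝ θ y.1)
      ((fderiv ℝ (fderiv ℝ θ) z.1).comp (ContinuousLinearMap.fst ℝ E E)) z :=
    hθ2.comp z hasFDerivAt_fst
  have h5 := h3.prodMk (h4.clm_apply (hasFDerivAt_snd (p := z)))
  have hev : ∀ᶠ y : E × E in 𝓝 z, y.1 ∈ (chartAt E p).target ∧
      (chartAt E p).symm y.1 ∈ (chartAt E p').source :=
    continuous_fst.continuousAt.eventually (Filter.Eventually.and
      ((chartAt E p).open_target.mem_nhds hz)
      (((chartAt E p).continuousAt_symm hz).eventually ((chartAt E p').open_source.mem_nhds hz')))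
  refine ⟨_, h5.congr_of_eventuallyEq (hev.mono fun y hy => tangentChart_transition hy.1 hy.2),
    fun w => ?_⟩
  simp [add_comm]

set_option maxSynthPendingDepth 3 in
theorem contDiffAt_christoffel [FiniteDimensional ℝ E] (g : RiemMetric E M) {p : M} {z : E × E}
    (hz : z.1 ∈ (chartAt E p).target) :
    ContDiffAt ℝ 1 (fun z : E × E => christoffel g p z.1 z.2 z.2) z := by
  have hI : ContDiffAt ℝ 1 (fun z : E × E => (metricInChart g p z.1).inverse) z :=
    ((contDiffAt_inverse_metricInChart g hz).of_le (by norm_num)).comp z contDiffAt_fst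
  have hD : ContDiffAt ℝ 1 (fun z : E × E => fderiv ℝ (metricInChart g p) z.1) z :=
    (((contDiffAt_metricInChart g hz).fderiv_right (m := 1)
      (WithTop.coe_le_coe.2 (le_top : (2 : ℕ∞) ≤ ⊤)))).comp z contDiffAt_fst
  have hw : ContDiffAt ℝ 1 (fun z : E × E => z.2) z := contDiffAt_snd
  have h1 : ContDiffAt ℝ 1 (fun z : E × E => fderiv ℝ (metricInChart g p) z.1 z.2 z.2) z :=
    (hD.clm_apply hw).clm_apply hw
  have h2 : ContDiffAt ℝ 1 (fun z : E × E => (fderiv ℝ (metricInChart g p) z.1).flip z.2) z :=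
    (((ContinuousLinearMap.flipₗᵢ ℝ E E (E →L[ℝ] ℝ)).contDiff (n := 1)).contDiffAt.comp z
      hD).clm_apply hw
  have h3 : ContDiffAt ℝ 1
      (fun z : E × E => ((fderiv ℝ (metricInChart g p) z.1).flip z.2).flip z.2) z :=
    (((ContinuousLinearMap.flipₗᵢ ℝ E E ℝ).contDiff (n := 1)).contDiffAt.comp z h2).clm_apply hw
  exact hI.clm_apply (((h1.add h1).sub h3).const_smul (1 / 2 : ℝ))

theorem tangentCoord_force {m : ℕ} (g : RiemMetric E M) (W : M → ℝ)
    (f : Fin m → ∀ q : M, TangentSpace 𝓘(ℝ, E) q) (u : EuclideanSpace ℝ (Fin m)) (p q : M) :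
    tangentCoord p q (force g W f u q) =
      -tangentCoord p q (grad g W q) + ∑ j, u j • tangentCoord p q (f j q) := by
  simp only [tangentCoord, force, map_add, map_neg, map_sum, map_smul]

variable [FiniteDimensional ℝ E] {m : ℕ} (g : RiemMetric E M) (W : M → ℝ)
  (f : Fin m → ∀ q : M, TangentSpace 𝓘(ℝ, E) q)

/-- The uncontrolled part of the dynamics in the chart attached to `p`. -/
def driftInChart (p : M) (z : E × E) : E × E :=
  (z.2, -tangentCoord p ((chartAt E p).symm z.1) (grad g W ((chartAt E p).symm z.1)) -
    christoffel g p z.1 z.2 z.2)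

/-- The controlled part of the dynamics in the chart attached to `p`. -/
def ctrlInChart (p : M) (z : E × E) :
    EuclideanSpace ℝ (Fin m) →L[ℝ] E × E :=
  ∑ j, (EuclideanSpace.proj j : EuclideanSpace ℝ (Fin m) →L[ℝ] ℝ).smulRight
    ((0 : E), tangentCoord p ((chartAt E p).symm z.1) (f j ((chartAt E p).symm z.1)))

omit [FiniteDimensional ℝ E] in
theorem driftInChart_add_ctrlInChart (p : M) (z : E × E) (u : EuclideanSpace ℝ (Fin m)) :
    driftInChart g W p z + ctrlInChart f p z u =
      (z.2, tangentCoord p ((chartAt E p).symm z.1) (force g W f u ((chartAt E p).symm z.1)) -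
        christoffel g p z.1 z.2 z.2) := by
  rw [tangentCoord_force, driftInChart, ctrlInChart, _root_.sum_apply]
  ext
  · simp [Prod.fst_sum]
  · simp [Prod.snd_sum]
    abel

/-- The controlled dynamics as a control-affine system on `TM`. -/
def tangentSystem (hW : ContMDiff 𝓘(ℝ, E) 𝓘(ℝ, ℝ) ∞ W) (hf : ∀ j, SmoothVectorField (f j)) :
    ControlSystem M (TangentBundle 𝓘(ℝ, E) M) (E × E) (EuclideanSpace ℝ (Fin m)) where
  chart := tangentChart
  drift := driftInChart g W
  ctrl := ctrlInChart f
  exists_mem_source y := ⟨y.proj, mem_tangentChart_source.2 (mem_chart_source E y.proj)⟩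
  contDiffAt_drift p z hz := by
    have hz' := mem_tangentChart_target.1 hz
    have hfd : ContDiffAt ℝ 1 (fderiv ℝ (W ∘ (chartAt E p).symm)) z.1 := by
      have h1 : ContMDiffOn 𝓘(ℝ, E) 𝓘(ℝ, ℝ) ∞ (W ∘ (chartAt E p).symm) (chartAt E p).target :=
        hW.comp_contMDiffOn contMDiffOn_chart_symm
      rw [contMDiffOn_iff_contDiffOn] at h1
      exact (h1.contDiffAt ((chartAt E p).open_target.mem_nhds hz')).fderiv_right
        (WithTop.coe_le_coe.2 (le_top : (2 : ℕ∞) ≤ ⊤))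
    have hgrad : ContDiffAt ℝ 1 (fun x => (metricInChart g p x).inverse
        (fderiv ℝ (W ∘ (chartAt E p).symm) x)) z.1 :=
      ((contDiffAt_inverse_metricInChart g hz').of_le (by norm_num)).clm_apply hfd
    have hgrad' : ContDiffAt ℝ 1 (fun x => tangentCoord p ((chartAt E p).symm x)
        (grad g W ((chartAt E p).symm x))) z.1 :=
      hgrad.congr_of_eventuallyEq (by
        filter_upwards [(chartAt E p).open_target.mem_nhds hz'] with x hx
          using tangentCoord_grad g hW hx)
    exact contDiffAt_snd.prodMk
      ((hgrad'.comp z contDiffAt_fst).neg.sub (contDiffAt_christoffel g hz'))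
  contDiffAt_ctrl p z hz := by
    have hz' := mem_tangentChart_target.1 hz
    refine ContDiffAt.sum fun j _ => contDiffAt_const.smulRight (contDiffAt_const.prodMk ?_)
    exact (((contDiffOn_tangentCoord (hf j) p).contDiffAt
      ((chartAt E p).open_target.mem_nhds hz')).of_le (by norm_num)).comp z contDiffAt_fst
  compat p p' z hz hz' := by
    have hz := mem_tangentChart_target.1 hz
    rw [tangentChart_symm_apply hz, mem_tangentChart_source] at hz'
    obtain ⟨D, hD, hD'⟩ := hasFDerivAt_tangentChart_transition hz hz'
    refine ⟨D, hD, fun u => ?_⟩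
    have hq : tangentCoord p' ((chartAt E p').symm (transition E p p' z.1))
        (force g W f u ((chartAt E p').symm (transition E p p' z.1))) =
        tangentCoord p' ((chartAt E p).symm z.1) (force g W f u ((chartAt E p).symm z.1)) :=
      congrArg (fun q => tangentCoord p' q (force g W f u q)) ((chartAt E p').left_inv hz')
    -- The second-derivative term of `hD'` cancels against the one from `christoffel_transition`.
    rw [driftInChart_add_ctrlInChart, driftInChart_add_ctrlInChart, hD',
      tangentChart_transition hz hz', map_sub, christoffel_transition g hz hz',
      ← tangentCoord_transition hz hz']
    refine Prod.ext rfl ?_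
    simp only [hq]
    abel

/-- A chart of `TM` covers all vectors over a chart of `M`, so the tests on subintervals coincide.
The equations for position and velocity are the two components of one equation in `E × E`. -/
theorem isTrajectory_iff_solvesOn (hW : ContMDiff 𝓘(ℝ, E) 𝓘(ℝ, ℝ) ∞ W)
    (hf : ∀ j, SmoothVectorField (f j)) {T : ℝ} {u : ℝ → EuclideanSpace ℝ (Fin m)}
    {γ : ℝ → TangentBundle 𝓘(ℝ, E) M} :
    IsTrajectory g W f T u γ ↔ (tangentSystem g W f hW hf).SolvesOn 0 T u γ := by
  have : CompleteSpace E := FiniteDimensional.complete ℝ E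
  have hrhs : ∀ p (y : TangentBundle 𝓘(ℝ, E) M) u, y.proj ∈ (chartAt E p).source →
      (tangentSystem g W f hW hf).rhs p (tangentChart p y) u =
        (tangentCoord p y.proj y.snd, tangentCoord p y.proj (force g W f u y.proj) -
          christoffel g p (chartAt E p y.proj) (tangentCoord p y.proj y.snd)
            (tangentCoord p y.proj y.snd)) := by
    intro p y u hy
    refine (driftInChart_add_ctrlInChart g W f p _ u).trans ?_
    have hq := congrArg (fun q => tangentCoord p q (force g W f u q)) ((chartAt E p).left_inv hy)
    beta_reduce at hq
    rw [tangentChart_apply hy, hq]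
  constructor
  · rintro ⟨⟨-, hv⟩, hc, ha⟩
    refine ⟨hc, fun p a b h0 hab hb hs => ?_⟩
    have hs' : ∀ t ∈ Icc a b, (γ t).proj ∈ (chartAt E p).source := fun t ht =>
      mem_tangentChart_source.1 (hs t ht)
    refine ((hv p a b ⟨h0, hab, hb, hs'⟩).prodMk (ha p a b ⟨h0, hab, hb, hs'⟩)).congr hab
      (fun t ht => tangentChart_apply (hs' t ht))
      (fun t ht => hrhs p (γ t) (u t) (hs' t (Ioc_subset_Icc_self ht)))
  · rintro ⟨hc, h⟩
    have key : ∀ p a b, InChart E T (fun t => (γ t).proj) p a b →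
        HasACDeriv (fun t => (chartAt E p (γ t).proj, tangentCoord p (γ t).proj (γ t).snd))
          (fun t => (tangentCoord p (γ t).proj (γ t).snd,
            tangentCoord p (γ t).proj (force g W f (u t) (γ t).proj) -
            christoffel g p (chartAt E p (γ t).proj) (tangentCoord p (γ t).proj (γ t).snd)
            (tangentCoord p (γ t).proj (γ t).snd))) a b := by
      rintro p a b ⟨h0, hab, hb, hs⟩
      exact (h p a b h0 hab hb fun t ht => mem_tangentChart_source.2 (hs t ht)).congr hab
        (fun t ht => (tangentChart_apply (hs t ht)).symm)
        fun t ht => (hrhs p (γ t) (u t) (hs t (Ioc_subset_Icc_self ht))).symm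
    exact ⟨⟨(FiberBundle.continuous_proj E (fun q : M => TangentSpace 𝓘(ℝ, E) q)).comp_continuousOn
      hc, fun p a b hi => (key p a b hi).clm_comp (ContinuousLinearMap.fst ℝ E E)⟩, hc,
      fun p a b hi => (key p a b hi).clm_comp (ContinuousLinearMap.snd ℝ E E)⟩

theorem accessibleSet_eq_reachable (hW : ContMDiff 𝓘(ℝ, E) 𝓘(ℝ, ℝ) ∞ W)
    (hf : ∀ j, SmoothVectorField (f j)) (Ω : Set (EuclideanSpace ℝ (Fin m)))
    (K : Set (TangentBundle 𝓘(ℝ, E) M)) (x₀ : TangentBundle 𝓘(ℝ, E) M) (T : ℝ) :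
    accessibleSet g W f Ω K x₀ T = (tangentSystem g W f hW hf).reachable Ω K x₀ T := by
  simp only [accessibleSet, ControlSystem.reachable, isTrajectory_iff_solvesOn g W f hW hf]

end TangentBundle

end RobotControl

end

theorem mainTheorem6
    {E : Type*} [NormedAddCommGroup E] [NormedSpace ℝ E] [FiniteDimensional ℝ E]
    {M : Type*} [TopologicalSpace M] [T2Space M] [SecondCountableTopology M]
    [ChartedSpace E M] [IsManifold 𝓘(ℝ, E) ∞ M]
    (g : RobotControl.RiemMetric E M)
    (W : M → ℝ) (hW : ContMDiff 𝓘(ℝ, E) 𝓘(ℝ, ℝ) ∞ W)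
    {m : ℕ} (f : Fin m → ∀ q : M, TangentSpace 𝓘(ℝ, E) q)
    (hf : ∀ j, RobotControl.SmoothVectorField (f j))
    (Ω : Set (EuclideanSpace ℝ (Fin m)))
    (hΩ_nonempty : Ω.Nonempty) (hΩ_convex : Convex ℝ Ω) (hΩ_compact : IsCompact Ω)
    (K : Set (TangentBundle 𝓘(ℝ, E) M)) (hK : IsCompact K)
    (x₀ : TangentBundle 𝓘(ℝ, E) M) :
    (∀ t : ℝ, 0 ≤ t → IsCompact (RobotControl.accessibleSet g W f Ω K x₀ t)) ∧
    (∀ T : ℝ, 0 ≤ T → RobotControl.TrajectoriesStayIn g W f Ω K x₀ T →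
      RobotControl.HausdorffContinuousOn
        (fun t => RobotControl.accessibleSet g W f Ω K x₀ t) (Icc 0 T)) := by
  have : T2Space (TangentBundle 𝓘(ℝ, E) M) := RobotControl.t2Space_tangentBundle
  simp only [RobotControl.accessibleSet_eq_reachable g W f hW hf]
  refine ⟨fun t ht => RobotControl.ControlSystem.isCompact_reachable _ hΩ_compact hΩ_convex hK x₀ ht,
    fun T _ hstay => RobotControl.ControlSystem.hausdorffContinuousOn_reachable _ hΩ_compact
      hΩ_nonempty hK x₀ fun r hr u γ hu hγ => hstay r hr u γ hu
        ((RobotControl.isTrajectory_iff_solvesOn g W f hW hf).2 hγ)⟩
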